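/- Let $\mathcal T=\mathbb R/2\pi\mathbb Z$ and let $\mathcal M_{\mathcal T}^0$ be the set of Borel probability measures $\mu$ on $\mathcal T$ with $\int_{\mathcal T} e^{i\theta}\,d\mu(\theta)=0$. Identify $\mathbb R^2$ with $\mathbb C$. For $\mu\in\mathcal M_{\mathcal T}^0$ put $F_\mu(x)=\mu([0,x])$ for $0\le x<2\pi$ and $F_\mu(x)=1$ for $x\ge 2\pi$; let $F_\mu^{-1}(y)=\inf\{x\ge 0: F_\mu(x)\ge y\}$ for $y\in[0,1]$, and $$Z_\mu(t)=\int_0^t e^{iF_\mu^{-1}(u)}\,du\quad(t\in[0,1]),\qquad \mathcal B_\mu=\{Z_\mu(t): t\in[0,1]\}.$$ For a compact convex set $S\subset\mathbb C$, the boundary of $S$ is $S$ minus its interior (so the boundary of a segment is the segment itself). The perimeter of $S$ is the length of its boundary curve if $S$ has nonempty interior, and $2|b-a|$ if $S$ is a segment $[a,b]$. Let $\mathrm{Conv}(1)$ be the set of compact convex sets $S\subset\mathbb C$ of perimeter $1$ that contain $0$, lie in $\{\operatorname{Im} z\ge 0\}$ and satisfy $S\cap\mathbb R\subset[0,\infty)$.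 For $\mu\in\mathcal M_{\mathcal T}^0$, let $\mathcal C_\mu$ be the element of $\mathrm{Conv}(1)$ whose boundary is $\mathcal B_\mu$. **Proposition.** Let $\mu,\nu\in\mathcal M_{\mathcal T}^0$ and $\lambda\in[0,1]$. Then $\lambda\mu+(1-\lambda)\nu\in\mathcal M_{\mathcal T}^0$; the sets $\mathcal C_\mu$, $\mathcal C_\nu$ and $\mathcal C_{\lambda\mu+(1-\lambda)\nu}$ are well defined (for each of the three measures there is exactly one element of $\mathrm{Conv}(1)$ with the required boundary); and $$\mathcal C_{\lambda\mu+(1-\lambda)\nu}=\lambda\,\mathcal C_\mu+(1-\lambda)\,\mathcal C_\nu ,$$ where $A+B=\{a+b: a\in A,\ b\in B\}$ and $\lambda A=\{\lambda a: a\in A\}$. -/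

import Mathlib

open scoped Pointwise

noncomputable section

namespace MixtureMinkowski

/-- The circle `ℝ / 2πℤ`, with its Borel σ-algebra. -/
abbrev Torus : Type := AddCircle (2 * Real.pi)

/-- Probability distributions `μ` on the circle with `∫ exp(iθ) dμ(θ) = 0`. -/
def centredMeasures : Set (MeasureTheory.Measure Torus) :=
  {μ | MeasureTheory.IsProbabilityMeasure μ ∧
    ∫ θ : Torus, ((AddCircle.toCircle θ : Circle) : ℂ) ∂μ = 0}

/-- The mixture `lam μ + (1 - lam) ν`. -/
def mixture (lam : ℝ) (μ ν : MeasureTheory.Measure Torus) : MeasureTheory.Measure Torus :=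
  ENNReal.ofReal lam • μ + ENNReal.ofReal (1 - lam) • ν

/-- The distribution function `F_μ(x) = μ([0,x])`, where `[0,x]` is an arc of the circle
(the whole circle once `x ≥ 2π`). -/
def distFun (μ : MeasureTheory.Measure Torus) (x : ℝ) : ℝ :=
  μ.real ((fun y : ℝ => (y : Torus)) '' Set.Icc 0 x)

/-- The generalised inverse `F_μ⁻¹(y) = inf {x ≥ 0 : F_μ(x) ≥ y}`, for `y ∈ [0,1]`. -/
def quantile (μ : MeasureTheory.Measure Torus) (y : ℝ) : ℝ :=
  sInf {x : ℝ | 0 ≤ x ∧ y ≤ distFun μ x}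

/-- `Z_μ(t) = ∫₀ᵗ exp(i F_μ⁻¹(u)) du`. -/
def curveParam (μ : MeasureTheory.Measure Torus) (t : ℝ) : ℂ :=
  ∫ u in (0 : ℝ)..t, Complex.exp (Complex.I * (quantile μ u : ℂ))

/-- `B_μ = {Z_μ(t) : t ∈ [0,1]}`. -/
def curve (μ : MeasureTheory.Measure Torus) : Set ℂ :=
  curveParam μ '' Set.Icc 0 1

/-- Nonempty compact convex subsets of the plane. -/
def IsCCS (S : Set ℂ) : Prop :=
  S.Nonempty ∧ IsCompact S ∧ Convex ℝ S

/-- The boundary of a compact convex set, namely `S` minus its interior. For a segment, whose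
interior in the plane is empty, this is the segment itself. -/
def ccsBoundary (S : Set ℂ) : Set ℂ :=
  S \ interior S

/-- `γ : [0,L] → ∂S` is a natural (arc length) parametrisation of the boundary of `S` as a
simple closed curve of length `L`. -/
def IsNaturalParam (S : Set ℂ) (L : ℝ) (γ : ℝ → ℂ) : Prop :=
  ContinuousOn γ (Set.Icc 0 L) ∧ Set.InjOn γ (Set.Ico 0 L) ∧ γ 0 = γ L ∧
    γ '' Set.Icc 0 L = ccsBoundary S ∧
    ∀ s ∈ Set.Icc 0 L, eVariationOn γ (Set.Icc 0 s) = ENNReal.ofReal s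

/-- The compact convex set `S` has perimeter `L`: the length of its boundary curve when `S` has
nonempty interior, and twice the length of `S` when `S` is a segment. -/
def HasPerimeter (S : Set ℂ) (L : ℝ) : Prop :=
  ((interior S).Nonempty ∧ 0 < L ∧ ∃ γ : ℝ → ℂ, IsNaturalParam S L γ) ∨
    ∃ a b : ℂ, S = segment ℝ a b ∧ L = 2 * ‖b - a‖

/-- Compact convex sets of perimeter 1 that contain the origin, lie above the `x`-axis, and meet
the `x`-axis only in nonnegative reals. -/
def convOne : Set (Set ℂ) :=
  {S | IsCCS S ∧ (0 : ℂ) ∈ S ∧ (∀ z ∈ S, 0 ≤ z.im) ∧ (∀ z ∈ S, z.im = 0 → 0 ≤ z.re) ∧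
    HasPerimeter S 1}

/-- `C_μ`: the inverse image of `B_μ` under the map sending a set in `convOne` to its boundary. -/
def ccs (μ : MeasureTheory.Measure Torus) : Set ℂ :=
  Function.invFunOn ccsBoundary convOne (curve μ)

end MixtureMinkowski

end

open Set MeasureTheory

namespace MixtureMinkowski

/-! A compact convex set is the convex hull of its boundary, so $\mathcal C_\mu$ can only be the
hull of the curve $\mathcal B_\mu$, and a closed convex set is determined by its supporting lines
(`eq_of_isLeast_height`). It therefore suffices that the support function of the hull is affine in
$\mu$.

The curve has unit speed and nondecreasing tangent angle $q=F_\mu^{-1}$ in $[0,2\pi)$, except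
possibly at the end of the parameter interval. Its height in direction $c$ changes at rate
$\sin(q-c)$ and is least where $q$ crosses $c$; the minimum is the integral of $\sin(q(u)-c)$ over
$q(u)\le c$. Since $q$ carries Lebesgue measure to $\mu$ (`map_quantile`), this equals
$\int_{\theta\le c}\sin(\theta-c)\,d\mu(\theta)$, whose integrand does not depend on $\mu$
(`isLeast_height_convexHull_curve`). Minkowski combinations combine support functions in the same
way.

The remaining work shows that the hull lies in `convOne` and has the curve as boundary. Sign
patterns of $\sin(q-c)$ show that every curve point lies on a supporting line and that the curve
fills each face (`ccsBoundary_convexHull`), that it is simple when the hull has interior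
(`angleCurve_ne`), and that it lies correctly relative to the real axis. Its length is found by
comparing chords with arcs (`eVariationOn_angleCurve`). -/

/-! ### Heights, supporting lines and faces in the plane. -/

/-- The signed distance `Im (exp (-ic) z)` of `z` from the line through `0` in direction `c`. -/
noncomputable def height (c : ℝ) : ℂ →L[ℝ] ℝ :=
  Real.cos c • Complex.imCLM - Real.sin c • Complex.reCLM

theorem height_apply (c : ℝ) (z : ℂ) :
    height c z = Real.cos c * z.im - Real.sin c * z.re := by
  simp [height]

theorem height_add_pi (c : ℝ) (z : ℂ) : height (c + Real.pi) z = -height c z := by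
  simp only [height_apply, Real.cos_add_pi, Real.sin_add_pi]; ring

theorem eq_of_height_eq {c : ℝ} {z w : ℂ} (h : height c z = height c w)
    (h' : height (c - Real.pi / 2) z = height (c - Real.pi / 2) w) : z = w := by
  simp only [height_apply, Real.cos_sub_pi_div_two, Real.sin_sub_pi_div_two] at h h'
  have hc := Real.sin_sq_add_cos_sq c
  apply Complex.ext
  · linear_combination Real.cos c * h' - Real.sin c * h - (z.re - w.re) * hc
  · linear_combination Real.sin c * h' + Real.cos c * h - (z.im - w.im) * hc

theorem abs_height_le (c : ℝ) (z : ℂ) : |height c z| ≤ ‖z‖ := by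
  apply abs_le_of_sq_le_sq _ (norm_nonneg z)
  rw [height_apply, Complex.sq_norm, Complex.normSq_apply]
  linear_combination sq_nonneg (Real.cos c * z.re + Real.sin c * z.im) +
    (z.re ^ 2 + z.im ^ 2) * Real.sin_sq_add_cos_sq c

theorem height_exp (c x : ℝ) : height c (Complex.exp (Complex.I * x)) = Real.sin (x - c) := by
  rw [mul_comm, height_apply, Complex.exp_ofReal_mul_I_re, Complex.exp_ofReal_mul_I_im,
    Real.sin_sub]
  ring

/-- The polar form of the vector $f(i)-i f(1)$ gives $r$ and $c$, because for `height c` this vector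
is $e^{ic}$. Thus heights suffice in every separation argument. -/
theorem exists_eq_smul_height (f : ℂ →L[ℝ] ℝ) :
    ∃ r : ℝ, 0 ≤ r ∧ ∃ c ∈ Ico 0 (2 * Real.pi), f = r • height c := by
  set w : ℂ := ⟨f Complex.I, -f 1⟩ with hw
  have key : ∀ c : ℝ, Real.cos c = Real.cos w.arg → Real.sin c = Real.sin w.arg →
      f = ‖w‖ • height c := by
    intro c h1 h2
    have hz : ∀ z : ℂ, f z = z.re * f 1 + z.im * f Complex.I := by
      intro z
      have : z = z.re • (1 : ℂ) + z.im • Complex.I := by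
        simp [Complex.re_add_im]
      conv_lhs => rw [this]
      rw [map_add, map_smul, map_smul, smul_eq_mul, smul_eq_mul]
    have e1 : ‖w‖ * Real.cos w.arg = f Complex.I := by
      rw [Complex.norm_mul_cos_arg]
    have e2 : ‖w‖ * Real.sin w.arg = -f 1 := by
      rw [Complex.norm_mul_sin_arg]
    refine ContinuousLinearMap.ext fun z => ?_
    rw [hz, smul_apply, height_apply, h1, h2, smul_eq_mul]
    linear_combination (-z.im) * e1 + z.re * e2
  refine ⟨‖w‖, norm_nonneg _, ?_⟩
  by_cases h : 0 ≤ w.arg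
  · exact ⟨w.arg, ⟨h, by linarith [Complex.arg_le_pi w, Real.pi_pos]⟩, key _ rfl rfl⟩
  · exact ⟨w.arg + 2 * Real.pi, ⟨by linarith [Complex.neg_pi_lt_arg w], by linarith⟩,
      key _ (Real.cos_add_two_pi _) (Real.sin_add_two_pi _)⟩

theorem subset_of_isLeast_height {A B : Set ℂ} (hB : IsClosed B) (hBc : Convex ℝ B)
    (h : ∀ c ∈ Ico 0 (2 * Real.pi), ∃ m, IsLeast (height c '' A) m ∧ IsLeast (height c '' B) m) :
    A ⊆ B := by
  intro z hz
  by_contra hzB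
  obtain ⟨f, u, hu, hf⟩ := geometric_hahn_banach_point_closed hBc hB hzB
  obtain ⟨r, hr, c, hc, rfl⟩ := exists_eq_smul_height f
  obtain ⟨m, hA, ⟨b, hb, hbm⟩, -⟩ := h c hc
  have h1 := hf b hb
  have h2 : m ≤ height c z := hA.2 ⟨z, hz, rfl⟩
  simp only [smul_apply, smul_eq_mul] at hu h1
  rw [hbm] at h1
  linarith [mul_le_mul_of_nonneg_left h2 hr]

/-- Two closed convex sets with the same supporting lines agree. -/
theorem eq_of_isLeast_height {A B : Set ℂ} (hA : IsClosed A) (hAc : Convex ℝ A)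
    (hB : IsClosed B) (hBc : Convex ℝ B)
    (h : ∀ c ∈ Ico 0 (2 * Real.pi), ∃ m, IsLeast (height c '' A) m ∧ IsLeast (height c '' B) m) :
    A = B :=
  (subset_of_isLeast_height hB hBc h).antisymm
    (subset_of_isLeast_height hA hAc fun c hc => (h c hc).imp fun _ hm => hm.symm)

theorem isLeast_image_convexHull {A : Set ℂ} {f : ℂ →L[ℝ] ℝ} {m : ℝ} (h : IsLeast (f '' A) m) :
    IsLeast (f '' convexHull ℝ A) m := by
  refine ⟨image_mono (subset_convexHull ℝ A) h.1, ?_⟩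
  rintro _ ⟨z, hz, rfl⟩
  have : convexHull ℝ A ⊆ {z | m ≤ f z} :=
    convexHull_min (fun a ha => h.2 ⟨a, ha, rfl⟩) (convex_halfSpace_ge f.toLinearMap.isLinear m)
  exact this hz

theorem isLeast_image_smul_add_smul {A B : Set ℂ} {f : ℂ →L[ℝ] ℝ} {m n a b : ℝ}
    (ha : 0 ≤ a) (hb : 0 ≤ b) (hA : IsLeast (f '' A) m) (hB : IsLeast (f '' B) n) :
    IsLeast (f '' (a • A + b • B)) (a * m + b * n) := by
  obtain ⟨⟨x, hx, rfl⟩, hA⟩ := hA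
  obtain ⟨⟨y, hy, rfl⟩, hB⟩ := hB
  refine ⟨⟨a • x + b • y, add_mem_add (smul_mem_smul_set hx) (smul_mem_smul_set hy),
    by rw [map_add, map_smul, map_smul, smul_eq_mul, smul_eq_mul]⟩, ?_⟩
  rintro _ ⟨_, ⟨_, ⟨x', hx', rfl⟩, _, ⟨y', hy', rfl⟩, rfl⟩, rfl⟩
  have h1 := mul_le_mul_of_nonneg_left (hA ⟨x', hx', rfl⟩) ha
  have h2 := mul_le_mul_of_nonneg_left (hB ⟨y', hy', rfl⟩) hb
  simp only [map_add, map_smul, smul_eq_mul]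
  exact add_le_add h1 h2

/-- A point of a convex hull that minimises a linear functional lies in the convex hull of the
minimising generators. -/
theorem mem_convexHull_inter_of_forall_le {A : Set ℂ} {f : ℂ →L[ℝ] ℝ} {p : ℂ}
    (hp : p ∈ convexHull ℝ A) (hmin : ∀ a ∈ A, f p ≤ f a) :
    p ∈ convexHull ℝ (A ∩ {z | f z = f p}) := by
  set H := convexHull ℝ (A ∩ {z | f z = f p})
  have hH : ∀ z ∈ H, f z = f p := fun z hz =>
    convexHull_min (inter_subset_right) (convex_hyperplane f.toLinearMap.isLinear (f p)) hz
  -- This union contains `A`, so once convex it contains `p`, which is not in the open half-plane.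
  have hconv : Convex ℝ ({z | f p < f z} ∪ H) := by
    rw [convex_iff_forall_pos]
    have hle : ∀ z ∈ {z | f p < f z} ∪ H, f p ≤ f z := by
      rintro z (hz | hz)
      · exact le_of_lt hz
      · exact (hH z hz).ge
    intro x hx y hy a b ha hb hab
    have e : f (a • x + b • y) = a * f x + b * f y := by
      rw [map_add, map_smul, map_smul, smul_eq_mul, smul_eq_mul]
    have e' : f p = a * f p + b * f p := by rw [← add_mul, hab, one_mul]
    have hx' := mul_le_mul_of_nonneg_left (hle x hx) ha.le
    have hy' := mul_le_mul_of_nonneg_left (hle y hy) hb.le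
    rcases hx with hx | hx
    · left
      have := mul_lt_mul_of_pos_left (show f p < f x from hx) ha
      show f p < _
      linarith
    rcases hy with hy | hy
    · left
      have := mul_lt_mul_of_pos_left (show f p < f y from hy) hb
      show f p < _
      linarith
    · exact Or.inr (convex_convexHull ℝ _ hx hy ha.le hb.le hab)
  have hsub : A ⊆ {z | f p < f z} ∪ H := fun a ha =>
    (hmin a ha).lt_or_eq.imp id fun h => subset_convexHull ℝ _ ⟨ha, h.symm⟩
  exact (convexHull_min hsub hconv hp).resolve_left (lt_irrefl (f p))

/-! ### Convex hulls, boundaries and interiors in the plane. -/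

theorem isCompact_convexJoin {A B : Set ℂ} (hA : IsCompact A) (hB : IsCompact B) :
    IsCompact (convexJoin ℝ A B) := by
  have : convexJoin ℝ A B =
      (fun x : ℂ × ℂ × ℝ => x.1 + x.2.2 • (x.2.1 - x.1)) '' (A ×ˢ B ×ˢ Icc (0 : ℝ) 1) := by
    ext z
    simp only [mem_convexJoin, segment_eq_image', mem_image, mem_prod, Prod.exists]
    constructor
    · rintro ⟨a, ha, b, hb, t, ht, rfl⟩
      exact ⟨a, b, t, ⟨ha, hb, ht⟩, rfl⟩
    · rintro ⟨a, b, t, ⟨ha, hb, ht⟩, rfl⟩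
      exact ⟨a, ha, b, hb, t, ht, rfl⟩
  rw [this]
  exact (hA.prod (hB.prod isCompact_Icc)).image (by fun_prop)

/-- By Carathéodory every point of the hull lies in a triangle with vertices in `A`, so the hull is
an iterated join of three copies of `A`. Smaller simplices are padded by repeating a vertex. -/
theorem isCompact_convexHull_complex {A : Set ℂ} (hA : IsCompact A) :
    IsCompact (convexHull ℝ A) := by
  have : convexHull ℝ A = convexJoin ℝ A (convexJoin ℝ A A) := by
    apply Subset.antisymm
    · rw [convexHull_eq_union]
      refine iUnion_subset fun t => iUnion_subset fun htA => iUnion_subset fun ht => ?_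
      have hcard : t.card ≤ 3 := by
        have := ht.card_le_finrank_succ
        have h2 : Module.finrank ℝ (vectorSpan ℝ (range ((↑) : t → ℂ))) ≤ 2 := by
          rw [← Complex.finrank_real_complex]; exact Submodule.finrank_le _
        simp only [Fintype.card_coe] at this
        omega
      rcases t.eq_empty_or_nonempty with rfl | hne
      · simp
      obtain ⟨a, b, c, habc⟩ : ∃ a b c : ℂ, (t : Set ℂ) = {a, b, c} := by
        have hpos := hne.card_pos
        have : t.card = 1 ∨ t.card = 2 ∨ t.card = 3 := by omega
        rcases this with h | h | h
        · obtain ⟨a, rfl⟩ := Finset.card_eq_one.1 h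
          exact ⟨a, a, a, by simp⟩
        · obtain ⟨a, b, -, rfl⟩ := Finset.card_eq_two.1 h
          exact ⟨a, b, b, by simp⟩
        · obtain ⟨a, b, c, -, -, -, rfl⟩ := Finset.card_eq_three.1 h
          exact ⟨a, b, c, by simp⟩
      rw [habc, convexHull_insert (by simp), convexHull_insert (by simp), convexHull_singleton]
      rw [habc] at htA
      have ha := htA (show a ∈ _ by simp)
      have hb := htA (show b ∈ _ by simp)
      have hc := htA (show c ∈ _ by simp)
      exact convexJoin_mono (singleton_subset_iff.2 ha)
        (convexJoin_mono (singleton_subset_iff.2 hb) (singleton_subset_iff.2 hc))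
    · have hs := subset_convexHull ℝ A
      have hc := convex_convexHull ℝ A
      exact convexJoin_subset hs (convexJoin_subset hs hs hc) hc
  rw [this]
  exact isCompact_convexJoin hA (isCompact_convexJoin hA hA)

/-- A compact convex subset of the plane is the convex hull of its boundary. -/
theorem convexHull_ccsBoundary {S : Set ℂ} (hS : IsCompact S) (hconv : Convex ℝ S) :
    convexHull ℝ (ccsBoundary S) = S := by
  apply (convexHull_min sdiff_subset hconv).antisymm
  intro z hz
  -- Every ray from `z` leaves the bounded set through a boundary point, the last one on the ray.
  -- Two opposite rays then place `z` between two boundary points.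
  have key : ∀ v : ℂ, v ≠ 0 → ∃ x : ℝ, 0 ≤ x ∧ z + x • v ∈ ccsBoundary S := by
    intro v hv
    set T := (fun x : ℝ => z + x • v) ⁻¹' S ∩ Ici 0
    have hcont : Continuous fun x : ℝ => z + x • v := by fun_prop
    have hTcl : IsClosed T := (hS.isClosed.preimage hcont).inter isClosed_Ici
    have hT0 : (0 : ℝ) ∈ T := ⟨by simpa using hz, mem_Ici.2 le_rfl⟩
    obtain ⟨R, hR⟩ := hS.isBounded.exists_norm_le
    have hTb : BddAbove T := by
      refine ⟨(R + ‖z‖) / ‖v‖, fun x hx => ?_⟩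
      have hv' : 0 < ‖v‖ := norm_pos_iff.2 hv
      rw [le_div_iff₀ hv']
      have h1 := hR _ hx.1
      have h2 : ‖x • v‖ ≤ ‖z + x • v‖ + ‖z‖ := by
        simpa using norm_sub_le (z + x • v) z
      rw [norm_smul, Real.norm_of_nonneg hx.2] at h2
      linarith
    have hmem := hTcl.csSup_mem ⟨0, hT0⟩ hTb
    refine ⟨sSup T, hmem.2, hmem.1, fun hint => ?_⟩
    have hnhds : (fun x : ℝ => z + x • v) ⁻¹' S ∈ nhds (sSup T) :=
      hcont.continuousAt.preimage_mem_nhds (mem_interior_iff_mem_nhds.1 hint)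
    obtain ⟨ε, hε, hball⟩ := Metric.mem_nhds_iff.1 hnhds
    have h3 : sSup T + ε / 2 ∈ T := by
      refine ⟨hball ?_, ?_⟩
      · rw [Metric.mem_ball, Real.dist_eq, add_sub_cancel_left, abs_of_pos (by linarith)]
        linarith
      · have := hmem.2
        simp only [mem_Ici] at *
        linarith
    linarith [le_csSup hTb h3]
  obtain ⟨x, hx, hxS⟩ := key 1 one_ne_zero
  obtain ⟨y, hy, hyS⟩ := key (-1) (by simp)
  rcases hx.eq_or_lt with rfl | hx'
  · have hzS : z ∈ ccsBoundary S := by simpa only [zero_smul, add_zero] using hxS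
    exact subset_convexHull ℝ _ hzS
  have hsum : 0 < x + y := by linarith
  have : z = (y / (x + y)) • (z + x • (1 : ℂ)) + (x / (x + y)) • (z + y • (-1 : ℂ)) := by
    have h' : (x : ℂ) + y ≠ 0 := by exact_mod_cast hsum.ne'
    simp only [Complex.real_smul]
    push_cast
    field_simp
    ring
  rw [this]
  exact convex_convexHull ℝ _ (subset_convexHull ℝ _ hxS) (subset_convexHull ℝ _ hyS)
    (by positivity) (by positivity) (by field_simp; ring)

theorem exists_height_lt_of_mem_interior {S : Set ℂ} {z : ℂ} (hz : z ∈ interior S) (c : ℝ) :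
    ∃ y ∈ S, height c y < height c z := by
  have hcont : Continuous fun x : ℝ => z + x • (⟨Real.sin c, -Real.cos c⟩ : ℂ) := by fun_prop
  have hnhds : (fun x : ℝ => z + x • (⟨Real.sin c, -Real.cos c⟩ : ℂ)) ⁻¹' S ∈ nhds 0 :=
    hcont.continuousAt.preimage_mem_nhds (by simpa using mem_interior_iff_mem_nhds.1 hz)
  obtain ⟨ε, hε, hball⟩ := Metric.mem_nhds_iff.1 hnhds
  have h1 : ε / 2 ∈ Metric.ball (0 : ℝ) ε := by
    rw [Metric.mem_ball, Real.dist_eq, sub_zero, abs_of_pos (by linarith)]; linarith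
  refine ⟨_, hball h1, ?_⟩
  have h2 : height c (⟨Real.sin c, -Real.cos c⟩ : ℂ) = -1 := by
    rw [height_apply]
    linear_combination -Real.sin_sq_add_cos_sq c
  rw [map_add, map_smul, h2, smul_eq_mul]
  linarith

theorem interior_eq_empty_of_height_eq_zero {S : Set ℂ} {c : ℝ} (h : ∀ z ∈ S, height c z = 0) :
    interior S = ∅ := by
  rw [Set.eq_empty_iff_forall_notMem]
  intro z hz
  obtain ⟨y, hy, hlt⟩ := exists_height_lt_of_mem_interior hz c
  rw [h y hy, h z (interior_subset hz)] at hlt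
  exact lt_irrefl _ hlt

/-- Empty interior makes the affine span proper; it passes through 0, so a nonzero linear functional
vanishes on it. Replacing $c$ by $c-\pi$ only flips the sign, which allows $c\in[0,\pi)$. -/
theorem exists_height_eq_zero_of_interior_eq_empty {A : Set ℂ} (h0 : (0 : ℂ) ∈ A)
    (h : interior (convexHull ℝ A) = ∅) :
    ∃ c ∈ Ico 0 Real.pi, ∀ z ∈ A, height c z = 0 := by
  have h1 : affineSpan ℝ A ≠ ⊤ := by
    rw [Ne, ← interior_convexHull_nonempty_iff_affineSpan_eq_top, h]
    simp
  have h2 : Submodule.span ℝ A ≠ ⊤ := by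
    intro h2
    apply h1
    have h3 := affineSpan_insert_zero (k := ℝ) A
    rw [insert_eq_of_mem h0, h2] at h3
    exact SetLike.coe_injective (h3.trans rfl)
  obtain ⟨f, hf, hker⟩ := Submodule.exists_le_ker_of_lt_top _ (lt_top_iff_ne_top.2 h2)
  obtain ⟨r, hr, c, hc, hfc⟩ := exists_eq_smul_height (LinearMap.toContinuousLinearMap f)
  have hr0 : r ≠ 0 := by
    rintro rfl
    apply hf
    ext z
    have := DFunLike.congr_fun hfc z
    simpa using this
  have hz : ∀ z ∈ A, height c z = 0 := by
    intro z hz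
    have h3 : f z = 0 := hker (Submodule.subset_span hz)
    have h4 : f z = r * height c z := by
      have := DFunLike.congr_fun hfc z
      simpa using this
    rw [h3] at h4
    exact (mul_eq_zero.1 h4.symm).resolve_left hr0
  by_cases hcπ : c < Real.pi
  · exact ⟨c, ⟨hc.1, hcπ⟩, hz⟩
  · refine ⟨c - Real.pi, ⟨by linarith, by linarith [hc.2]⟩, fun z hzA => ?_⟩
    have := height_add_pi (c - Real.pi) z
    rw [sub_add_cancel, hz z hzA] at this
    linarith

/-! ### Functions on a circle with one descent and one ascent. -/

/-- `t` minimises `g` on `[0,1]`, and the set of minimisers is an interval or, after identifying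
`0` with `1`, an arc. -/
def IsCyclicMin (g : ℝ → ℝ) (t : ℝ) : Prop :=
  (∀ s ∈ Icc (0 : ℝ) 1, g t ≤ g s) ∧
    ∀ s₁ ∈ Icc (0 : ℝ) 1, ∀ s₂ ∈ Icc (0 : ℝ) 1, s₁ ≤ s₂ → g s₁ = g t → g s₂ = g t →
      (∀ s ∈ Icc s₁ s₂, g s = g t) ∨
        ((∀ s ∈ Icc 0 s₁, g s = g t) ∧ ∀ s ∈ Icc s₂ 1, g s = g t)

/-- On $[0,w]$ the minimum level set is an interval. If the minimum is also taken beyond $w$, then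
`g` stays there until 1, hence $g(0)=g(1)$ is minimal too and the level set wraps around the
endpoint. -/
theorem IsCyclicMin.of_antitone_monotone_antitone {g : ℝ → ℝ} {t w : ℝ} (ht : 0 ≤ t) (htw : t ≤ w)
    (hw : w ≤ 1) (h1 : AntitoneOn g (Icc 0 t)) (h2 : MonotoneOn g (Icc t w))
    (h3 : AntitoneOn g (Icc w 1)) (h01 : g 0 = g 1) : IsCyclicMin g t := by
  have hmin : ∀ s ∈ Icc (0 : ℝ) 1, g t ≤ g s := by
    intro s hs
    rcases le_total s t with hst | hst
    · exact h1 ⟨hs.1, hst⟩ ⟨ht, le_rfl⟩ hst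
    rcases le_total s w with hsw | hsw
    · exact h2 ⟨le_rfl, htw⟩ ⟨hst, hsw⟩ hst
    · have e1 := h3 ⟨hsw, hs.2⟩ ⟨hw, le_rfl⟩ hs.2
      have e2 := h1 ⟨le_rfl, ht⟩ ⟨ht, le_rfl⟩ ht
      linarith
  have hval : ∀ s₁ s₂ : ℝ, 0 ≤ s₁ → s₂ ≤ w → g s₁ = g t → g s₂ = g t →
      ∀ s ∈ Icc s₁ s₂, g s = g t := by
    intro s₁ s₂ hs₁ hs₂ e1 e2 s hs
    apply le_antisymm _ (hmin s ⟨hs₁.trans hs.1, hs.2.trans (hs₂.trans hw)⟩)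
    rcases le_total s t with hst | hst
    · exact (h1 ⟨hs₁, hs.1.trans hst⟩ ⟨hs₁.trans hs.1, hst⟩ hs.1).trans e1.le
    · exact (h2 ⟨hst, hs.2.trans hs₂⟩ ⟨hst.trans hs.2, hs₂⟩ hs.2).trans e2.le
  refine ⟨hmin, fun s₁ hs₁ s₂ hs₂ h12 e1 e2 => ?_⟩
  rcases le_total s₂ w with hs₂w | hs₂w
  · exact Or.inl (hval s₁ s₂ hs₁.1 hs₂w e1 e2)
  rcases le_total w s₁ with hs₁w | hs₁w
  · left
    intro s hs
    have hs01 : s ∈ Icc (0 : ℝ) 1 := ⟨hs₁.1.trans hs.1, hs.2.trans hs₂.2⟩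
    exact ((h3 ⟨hs₁w, hs₁.2⟩ ⟨hs₁w.trans hs.1, hs01.2⟩ hs.1).trans e1.le).antisymm (hmin s hs01)
  · right
    have htail : ∀ s ∈ Icc s₂ 1, g s = g t := fun s hs =>
      ((h3 ⟨hs₂w, hs₂.2⟩ ⟨hs₂w.trans hs.1, hs.2⟩ hs.1).trans e2.le).antisymm
        (hmin s ⟨hs₂.1.trans hs.1, hs.2⟩)
    exact ⟨hval 0 s₁ le_rfl hs₁w (h01.trans (htail 1 ⟨hs₂.2, le_rfl⟩)) e1, htail⟩

theorem IsCyclicMin.of_monotone_antitone_monotone {g : ℝ → ℝ} {t w : ℝ} (hw : 0 ≤ w) (hwt : w ≤ t)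
    (ht : t ≤ 1) (h1 : MonotoneOn g (Icc 0 w)) (h2 : AntitoneOn g (Icc w t))
    (h3 : MonotoneOn g (Icc t 1)) (h01 : g 0 = g 1) : IsCyclicMin g t := by
  -- Reversing the parameter turns this sign pattern into the previous one.
  have key : IsCyclicMin (fun s => g (1 - s)) (1 - t) := by
    refine IsCyclicMin.of_antitone_monotone_antitone (w := 1 - w) (by linarith) (by linarith)
      (by linarith) ?_ ?_ ?_ (by simpa using h01.symm)
    · exact fun a ha b hb hab => h3 ⟨by linarith [hb.2], by linarith [hb.1]⟩
        ⟨by linarith [ha.2], by linarith [ha.1]⟩ (by linarith)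
    · exact fun a ha b hb hab => h2 ⟨by linarith [hb.2], by linarith [hb.1]⟩
        ⟨by linarith [ha.2], by linarith [ha.1]⟩ (by linarith)
    · exact fun a ha b hb hab => h1 ⟨by linarith [hb.2], by linarith [hb.1]⟩
        ⟨by linarith [ha.2], by linarith [ha.1]⟩ (by linarith)
  obtain ⟨k1, k2⟩ := key
  simp only [sub_sub_cancel] at k1 k2
  have hrefl : ∀ {a b s : ℝ}, s ∈ Icc a b → 1 - s ∈ Icc (1 - b) (1 - a) := fun hs =>
    ⟨by linarith [hs.2], by linarith [hs.1]⟩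
  have hrefl' : ∀ {s : ℝ}, s ∈ Icc (0 : ℝ) 1 → 1 - s ∈ Icc (0 : ℝ) 1 := fun hs => by
    simpa using hrefl hs
  refine ⟨fun s hs => by simpa using k1 (1 - s) (hrefl' hs), fun s₁ hs₁ s₂ hs₂ h12 e1 e2 => ?_⟩
  rcases k2 (1 - s₂) (hrefl' hs₂) (1 - s₁) (hrefl' hs₁) (by linarith) (by simpa using e2)
    (by simpa using e1) with h | ⟨h, h'⟩
  · exact Or.inl fun s hs => by simpa using h (1 - s) (hrefl hs)
  · refine Or.inr ⟨fun s hs => ?_, fun s hs => ?_⟩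
    · simpa using h' (1 - s) (by simpa using hrefl hs)
    · simpa using h (1 - s) (by simpa using hrefl hs)

/-! ### Closed curves with monotone tangent angle. -/

/-- A monotone choice of tangent angles for a closed curve of length one. -/
structure IsAngle (q : ℝ → ℝ) : Prop where
  monotoneOn : MonotoneOn q (Icc 0 1)
  nonneg : ∀ u ∈ Icc (0 : ℝ) 1, 0 ≤ q u
  -- The endpoint is left out because a quantile function may equal $2\pi$ at $u=1$.
  lt_two_pi : ∀ u ∈ Ico (0 : ℝ) 1, q u < 2 * Real.pi
  integral_eq_zero : ∫ u in (0 : ℝ)..1, Complex.exp (Complex.I * (q u : ℂ)) = 0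

/-- The curve with tangent angle `q`. -/
noncomputable def angleCurve (q : ℝ → ℝ) (t : ℝ) : ℂ :=
  ∫ u in (0 : ℝ)..t, Complex.exp (Complex.I * (q u : ℂ))

theorem angleCurve_zero (q : ℝ → ℝ) : angleCurve q 0 = 0 :=
  intervalIntegral.integral_same

namespace IsAngle

variable {q : ℝ → ℝ}

theorem angleCurve_one (hq : IsAngle q) : angleCurve q 1 = 0 :=
  hq.integral_eq_zero

theorem exists_crossing (hq : IsAngle q) {P : ℝ → Prop} (hP : ∀ x y, x ≤ y → P y → P x) :
    ∃ t ∈ Icc (0 : ℝ) 1, (∀ u ∈ Ico 0 t, P (q u)) ∧ ∀ u ∈ Ioc t 1, ¬P (q u) := by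
  -- Inserting 0 keeps the set nonempty when `P` fails everywhere. Nothing is claimed at the
  -- crossing point itself beyond these one-sided statements.
  set T : Set ℝ := insert 0 {u | u ∈ Icc (0 : ℝ) 1 ∧ P (q u)}
  have hT : ∀ u ∈ T, u ∈ Icc (0 : ℝ) 1 := by
    rintro u (rfl | hu)
    · exact ⟨le_rfl, zero_le_one⟩
    · exact hu.1
  have hbdd : BddAbove T := ⟨1, fun u hu => (hT u hu).2⟩
  have hne : T.Nonempty := ⟨0, mem_insert _ _⟩
  refine ⟨sSup T, ⟨le_csSup hbdd (mem_insert _ _), csSup_le hne fun u hu => (hT u hu).2⟩, ?_, ?_⟩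
  · intro u hu
    obtain ⟨v, hv, huv⟩ := exists_lt_of_lt_csSup hne hu.2
    rcases hv with rfl | hv
    · exact absurd huv (not_lt.2 hu.1)
    · exact hP _ _ (hq.monotoneOn ⟨hu.1, huv.le.trans hv.1.2⟩ hv.1 huv.le) hv.2
  · intro u hu hPu
    have h0 : 0 ≤ sSup T := le_csSup hbdd (mem_insert _ _)
    exact absurd (le_csSup hbdd (Or.inr ⟨⟨h0.trans hu.1.le, hu.2⟩, hPu⟩)) (not_le.2 hu.1)

theorem intervalIntegrable_comp {E : Type*} [NormedAddCommGroup E] [MeasurableSpace E]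
    [BorelSpace E] [SecondCountableTopology E] (hq : IsAngle q) {f : ℝ → E}
    (hf : Continuous f) (hb : ∀ x, ‖f x‖ ≤ 1) {a b : ℝ} (ha : a ∈ Icc (0 : ℝ) 1)
    (hb' : b ∈ Icc (0 : ℝ) 1) : IntervalIntegrable (fun u => f (q u)) volume a b := by
  have h1 : IntegrableOn (fun u => f (q u)) (Icc 0 1) := by
    have hm : AEMeasurable q (volume.restrict (Icc 0 1)) :=
      aemeasurable_restrict_of_monotoneOn measurableSet_Icc hq.monotoneOn
    refine Integrable.mono' (g := fun _ => (1 : ℝ)) (integrable_const _)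
      (hf.measurable.comp_aemeasurable hm).aestronglyMeasurable (Filter.Eventually.of_forall ?_)
    exact fun u => hb _
  have h2 := (intervalIntegrable_iff_integrableOn_Icc_of_le zero_le_one).2 h1
  refine h2.mono_set ?_
  rw [uIcc_of_le zero_le_one]
  exact ordConnected_Icc.uIcc_subset ha hb'

theorem intervalIntegrable_exp (hq : IsAngle q) {a b : ℝ} (ha : a ∈ Icc (0 : ℝ) 1)
    (hb : b ∈ Icc (0 : ℝ) 1) :
    IntervalIntegrable (fun u => Complex.exp (Complex.I * (q u : ℂ))) volume a b :=
  hq.intervalIntegrable_comp (f := fun x : ℝ => Complex.exp (Complex.I * (x : ℂ)))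
    (by fun_prop) (fun x => by rw [mul_comm, Complex.norm_exp_ofReal_mul_I]) ha hb

theorem intervalIntegrable_sin (hq : IsAngle q) (c : ℝ) {a b : ℝ} (ha : a ∈ Icc (0 : ℝ) 1)
    (hb : b ∈ Icc (0 : ℝ) 1) :
    IntervalIntegrable (fun u => Real.sin (q u - c)) volume a b :=
  hq.intervalIntegrable_comp (f := fun x : ℝ => Real.sin (x - c))
    (by fun_prop) (fun x => Real.abs_sin_le_one _) ha hb

theorem angleCurve_sub (hq : IsAngle q) {a b : ℝ} (ha : a ∈ Icc (0 : ℝ) 1)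
    (hb : b ∈ Icc (0 : ℝ) 1) :
    angleCurve q b - angleCurve q a = ∫ u in a..b, Complex.exp (Complex.I * (q u : ℂ)) := by
  have h0 : (0 : ℝ) ∈ Icc (0 : ℝ) 1 := ⟨le_rfl, zero_le_one⟩
  exact intervalIntegral.integral_interval_sub_left (hq.intervalIntegrable_exp h0 hb)
    (hq.intervalIntegrable_exp h0 ha)

/-- The geometry of the curve is read off from this formula by tracking the sign of $\sin(q-c)$. -/
theorem height_angleCurve_sub (hq : IsAngle q) (c : ℝ) {a b : ℝ} (ha : a ∈ Icc (0 : ℝ) 1)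
    (hb : b ∈ Icc (0 : ℝ) 1) :
    height c (angleCurve q b) - height c (angleCurve q a) = ∫ u in a..b, Real.sin (q u - c) := by
  rw [← map_sub, hq.angleCurve_sub ha hb,
    ← (height c).intervalIntegral_comp_comm (hq.intervalIntegrable_exp ha hb)]
  simp only [height_exp]

theorem height_angleCurve_le (hq : IsAngle q) {c a b : ℝ} (ha : 0 ≤ a) (hab : a ≤ b) (hb : b ≤ 1)
    (h : ∀ u ∈ Ioo a b, 0 ≤ Real.sin (q u - c)) :
    height c (angleCurve q a) ≤ height c (angleCurve q b) := by
  rw [← sub_nonneg, hq.height_angleCurve_sub c ⟨ha, hab.trans hb⟩ ⟨ha.trans hab, hb⟩,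
    intervalIntegral.integral_of_le hab, integral_Ioc_eq_integral_Ioo]
  exact setIntegral_nonneg measurableSet_Ioo h

theorem height_angleCurve_lt (hq : IsAngle q) {c a b : ℝ} (ha : 0 ≤ a) (hab : a < b) (hb : b ≤ 1)
    (h : ∀ u ∈ Ioo a b, 0 < Real.sin (q u - c)) :
    height c (angleCurve q a) < height c (angleCurve q b) := by
  have ha' : a ∈ Icc (0 : ℝ) 1 := ⟨ha, hab.le.trans hb⟩
  have hb' : b ∈ Icc (0 : ℝ) 1 := ⟨ha.trans hab.le, hb⟩
  rw [← sub_pos, hq.height_angleCurve_sub c ha' hb']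
  exact intervalIntegral.intervalIntegral_pos_of_pos_on (hq.intervalIntegrable_sin c ha' hb') h hab

theorem height_angleCurve_gt (hq : IsAngle q) {c a b : ℝ} (ha : 0 ≤ a) (hab : a < b) (hb : b ≤ 1)
    (h : ∀ u ∈ Ioo a b, Real.sin (q u - c) < 0) :
    height c (angleCurve q b) < height c (angleCurve q a) := by
  -- Turning the direction by $\pi$ negates both the height and the sine.
  have := hq.height_angleCurve_lt (c := c + Real.pi) ha hab hb fun u hu => by
    rw [← sub_sub, Real.sin_sub_pi]
    linarith [h u hu]
  rw [height_add_pi, height_add_pi] at this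
  linarith

theorem monotoneOn_height (hq : IsAngle q) {c a b : ℝ} (ha : 0 ≤ a) (hb : b ≤ 1)
    (h : ∀ u ∈ Ioo a b, 0 ≤ Real.sin (q u - c)) :
    MonotoneOn (fun s => height c (angleCurve q s)) (Icc a b) := fun _ hx _ hy hxy =>
  hq.height_angleCurve_le (ha.trans hx.1) hxy (hy.2.trans hb) fun u hu =>
    h u ⟨hx.1.trans_lt hu.1, hu.2.trans_le hy.2⟩

theorem antitoneOn_height (hq : IsAngle q) {c a b : ℝ} (ha : 0 ≤ a) (hb : b ≤ 1)
    (h : ∀ u ∈ Ioo a b, Real.sin (q u - c) ≤ 0) :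
    AntitoneOn (fun s => height c (angleCurve q s)) (Icc a b) := by
  have := hq.monotoneOn_height (c := c + Real.pi) ha hb fun u hu => by
    rw [← sub_sub, Real.sin_sub_pi]
    linarith [h u hu]
  intro x hx y hy hxy
  have := this hx hy hxy
  simp only [height_add_pi] at this
  exact neg_le_neg_iff.1 this

/-- The difference $q-c$ runs monotonically through part of $[-c,2\pi-c)$. If $c\le\pi$, the sine is
nonpositive up to $t$, nonnegative until $q$ passes $c+\pi$, then nonpositive. If $c>\pi$, it is
nonnegative until $q$ passes $c-\pi$, nonpositive up to $t$, then nonnegative. -/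
theorem isCyclicMin_height (hq : IsAngle q) {c t : ℝ} (hc : c ∈ Ico 0 (2 * Real.pi))
    (ht : t ∈ Icc (0 : ℝ) 1) (hle : ∀ u ∈ Ioo 0 t, q u ≤ c) (hge : ∀ u ∈ Ioo t 1, c ≤ q u) :
    IsCyclicMin (fun s => height c (angleCurve q s)) t := by
  have h01 : height c (angleCurve q 0) = height c (angleCurve q 1) := by
    rw [angleCurve_zero, hq.angleCurve_one]
  have hpi := Real.pi_pos
  have hnonneg : ∀ u, 0 < u → u < 1 → 0 ≤ q u := fun u h h' => hq.nonneg u ⟨h.le, h'.le⟩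
  have hlt : ∀ u, 0 < u → u < 1 → q u < 2 * Real.pi := fun u h h' => hq.lt_two_pi u ⟨h.le, h'⟩
  rcases le_or_gt c Real.pi with hcπ | hcπ
  · obtain ⟨w, hw, hwle, hwgt⟩ := hq.exists_crossing (P := fun x => x ≤ c + Real.pi)
      fun x y hxy hy => hxy.trans hy
    -- Using the maximum spares a comparison of the two crossing points.
    refine IsCyclicMin.of_antitone_monotone_antitone (w := max t w) ht.1 (le_max_left _ _)
      (max_le ht.2 hw.2) (hq.antitoneOn_height le_rfl ht.2 fun u hu => ?_)
      (hq.monotoneOn_height ht.1 (max_le ht.2 hw.2) fun u hu => ?_)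
      (hq.antitoneOn_height (ht.1.trans (le_max_left _ _)) le_rfl fun u hu => ?_) h01
    · have := hnonneg u hu.1 (hu.2.trans_le ht.2)
      exact Real.sin_nonpos_of_nonpos_of_neg_pi_le (by linarith [hle u hu]) (by linarith)
    · have huw : u < w := (lt_max_iff.1 hu.2).resolve_left (not_lt.2 hu.1.le)
      have h1 := hge u ⟨hu.1, huw.trans_le hw.2⟩
      have h2 := hwle u ⟨ht.1.trans hu.1.le, huw⟩
      exact Real.sin_nonneg_of_nonneg_of_le_pi (by linarith) (by linarith)
    · have h1 := hwgt u ⟨(le_max_right _ _).trans_lt hu.1, hu.2.le⟩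
      have h2 := hlt u ((ht.1.trans (le_max_left t w)).trans_lt hu.1) hu.2
      rw [← Real.sin_sub_two_pi]
      exact Real.sin_nonpos_of_nonpos_of_neg_pi_le (by linarith [hc.1]) (by linarith)
  · obtain ⟨w, hw, hwle, hwgt⟩ := hq.exists_crossing (P := fun x => x ≤ c - Real.pi)
      fun x y hxy hy => hxy.trans hy
    refine IsCyclicMin.of_monotone_antitone_monotone (w := min t w) (le_min ht.1 hw.1)
      (min_le_left _ _) ht.2
      (hq.monotoneOn_height le_rfl ((min_le_left _ _).trans ht.2) fun u hu => ?_)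
      (hq.antitoneOn_height (le_min ht.1 hw.1) ht.2 fun u hu => ?_)
      (hq.monotoneOn_height ht.1 le_rfl fun u hu => ?_) h01
    · have h1 := hwle u ⟨hu.1.le, hu.2.trans_le (min_le_right _ _)⟩
      have h2 := hnonneg u hu.1 (hu.2.trans_le ((min_le_left _ _).trans ht.2))
      rw [← Real.sin_add_two_pi]
      exact Real.sin_nonneg_of_nonneg_of_le_pi (by linarith [hc.2]) (by linarith)
    · have huw : w < u := (min_lt_iff.1 hu.1).resolve_left (not_lt.2 hu.2.le)
      have h0 : 0 < u := hw.1.trans_lt huw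
      have h1 := hwgt u ⟨huw, hu.2.le.trans ht.2⟩
      have h2 := hle u ⟨h0, hu.2⟩
      exact Real.sin_nonpos_of_nonpos_of_neg_pi_le (by linarith) (by linarith)
    · have h1 := hge u hu
      have h2 := hlt u (ht.1.trans_lt hu.1) hu.2
      exact Real.sin_nonneg_of_nonneg_of_le_pi (by linarith) (by linarith)

/-! ### The curve as the boundary of its convex hull. -/

theorem lipschitzOnWith_angleCurve (hq : IsAngle q) :
    LipschitzOnWith 1 (angleCurve q) (Icc 0 1) := by
  refine LipschitzOnWith.of_dist_le_mul fun x hx y hy => ?_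
  rw [dist_eq_norm, hq.angleCurve_sub hy hx, NNReal.coe_one, Real.dist_eq]
  refine intervalIntegral.norm_integral_le_of_norm_le_const fun u _ => ?_
  rw [mul_comm, Complex.norm_exp_ofReal_mul_I]

theorem continuousOn_angleCurve (hq : IsAngle q) : ContinuousOn (angleCurve q) (Icc 0 1) :=
  hq.lipschitzOnWith_angleCurve.continuousOn

theorem continuousOn_height (hq : IsAngle q) (c : ℝ) :
    ContinuousOn (fun s => height c (angleCurve q s)) (Icc 0 1) :=
  (height c).continuous.comp_continuousOn hq.continuousOn_angleCurve

theorem isCompact_convexHull (hq : IsAngle q) :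
    IsCompact (convexHull ℝ (angleCurve q '' Icc 0 1)) :=
  isCompact_convexHull_complex (isCompact_Icc.image_of_continuousOn hq.continuousOn_angleCurve)

theorem exists_isCyclicMin (hq : IsAngle q) {c : ℝ} (hc : c ∈ Ico 0 (2 * Real.pi)) :
    ∃ t ∈ Icc (0 : ℝ) 1, IsCyclicMin (fun s => height c (angleCurve q s)) t := by
  obtain ⟨t, ht, hle, hgt⟩ := hq.exists_crossing (P := fun x => x ≤ c)
    fun x y hxy hy => hxy.trans hy
  exact ⟨t, ht, hq.isCyclicMin_height hc ht (fun u hu => hle u ⟨hu.1.le, hu.2⟩)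
    fun u hu => (not_le.1 (hgt u ⟨hu.1, hu.2.le⟩)).le⟩

/-- The tangent at each parameter $r<1$ supports the curve, whereas an interior point of the hull
can always be lowered. The parameter 1 is traded for 0, since the bound on `q` may fail there. -/
theorem angleCurve_mem_ccsBoundary (hq : IsAngle q) {s : ℝ} (hs : s ∈ Icc (0 : ℝ) 1) :
    angleCurve q s ∈ ccsBoundary (convexHull ℝ (angleCurve q '' Icc 0 1)) := by
  refine ⟨subset_convexHull ℝ _ (mem_image_of_mem _ hs), fun hint => ?_⟩
  have key : ∀ r ∈ Ico (0 : ℝ) 1, angleCurve q r = angleCurve q s → False := by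
    intro r hr hrs
    have hr' := Ico_subset_Icc_self hr
    have hmin := (hq.isCyclicMin_height ⟨hq.nonneg r hr', hq.lt_two_pi r hr⟩ hr'
      (fun u hu => hq.monotoneOn ⟨hu.1.le, hu.2.le.trans hr'.2⟩ hr' hu.2.le)
      (fun u hu => hq.monotoneOn hr' ⟨hr'.1.trans hu.1.le, hu.2.le⟩ hu.1.le)).1
    have hleast : IsLeast (height (q r) '' (angleCurve q '' Icc 0 1))
        (height (q r) (angleCurve q r)) := by
      refine ⟨mem_image_of_mem _ (mem_image_of_mem _ hr'), ?_⟩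
      rintro _ ⟨_, ⟨u, hu, rfl⟩, rfl⟩
      exact hmin u hu
    obtain ⟨y, hy, hlt⟩ := exists_height_lt_of_mem_interior hint (q r)
    rw [← hrs] at hlt
    exact absurd ((isLeast_image_convexHull hleast).2 ⟨y, hy, rfl⟩) (not_le.2 hlt)
  rcases hs.2.lt_or_eq with h | rfl
  · exact key s ⟨hs.1, h⟩ rfl
  · exact key 0 ⟨le_rfl, zero_lt_one⟩ (by rw [angleCurve_zero, hq.angleCurve_one])

/-- The minimising parameters between two face points form an arc on which `height c` is constant.
The perpendicular coordinate is continuous, so the intermediate value theorem fills the segment. -/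
theorem convex_curve_inter_height (hq : IsAngle q) {c m : ℝ} (hc : c ∈ Ico 0 (2 * Real.pi))
    (hm : ∀ s ∈ Icc (0 : ℝ) 1, m ≤ height c (angleCurve q s)) :
    Convex ℝ (angleCurve q '' Icc 0 1 ∩ {z | height c z = m}) := by
  obtain ⟨t, ht, hmin, harc⟩ := hq.exists_isCyclicMin hc
  rw [convex_iff_segment_subset]
  have key : ∀ s₁ ∈ Icc (0 : ℝ) 1, ∀ s₂ ∈ Icc (0 : ℝ) 1, s₁ ≤ s₂ →
      height c (angleCurve q s₁) = m → height c (angleCurve q s₂) = m →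
      segment ℝ (angleCurve q s₁) (angleCurve q s₂) ⊆
        angleCurve q '' Icc 0 1 ∩ {z | height c z = m} := by
    intro s₁ hs₁ s₂ hs₂ h12 e1 e2 x hx
    have htm : height c (angleCurve q t) = m := ((hmin s₁ hs₁).trans e1.le).antisymm (hm t ht)
    have hxm : height c x = m :=
      (convex_hyperplane (height c).toLinearMap.isLinear m).segment_subset e1 e2 hx
    have hx' : height (c - Real.pi / 2) x ∈ uIcc (height (c - Real.pi / 2) (angleCurve q s₁))
        (height (c - Real.pi / 2) (angleCurve q s₂)) := by
      rw [← segment_eq_uIcc]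
      have := mem_image_of_mem (height (c - Real.pi / 2)) hx
      have h2 := image_segment ℝ (height (c - Real.pi / 2)).toLinearMap.toAffineMap
        (angleCurve q s₁) (angleCurve q s₂)
      exact h2 ▸ this
    have hivt : ∀ a b : ℝ, a ∈ Icc (0 : ℝ) 1 → b ∈ Icc (0 : ℝ) 1 → a ≤ b →
        (∀ s ∈ Icc a b, height c (angleCurve q s) = m) →
        height (c - Real.pi / 2) x ∈ uIcc (height (c - Real.pi / 2) (angleCurve q a))
          (height (c - Real.pi / 2) (angleCurve q b)) →
        x ∈ angleCurve q '' Icc 0 1 ∩ {z | height c z = m} := by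
      intro a b ha hb hab hconst hmem
      have hsub : Icc a b ⊆ Icc 0 1 := Icc_subset_Icc ha.1 hb.2
      obtain ⟨s, hs, hsx⟩ := intermediate_value_uIcc
        (f := fun s => height (c - Real.pi / 2) (angleCurve q s)) (a := a) (b := b)
        (by rw [uIcc_of_le hab]; exact (hq.continuousOn_height _).mono hsub) hmem
      rw [uIcc_of_le hab] at hs
      exact ⟨⟨s, hsub hs, eq_of_height_eq ((hconst s hs).trans hxm.symm) hsx⟩, hxm⟩
    have h0 : (0 : ℝ) ∈ Icc (0 : ℝ) 1 := ⟨le_rfl, zero_le_one⟩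
    have h1 : (1 : ℝ) ∈ Icc (0 : ℝ) 1 := ⟨zero_le_one, le_rfl⟩
    rcases harc s₁ hs₁ s₂ hs₂ h12 (e1.trans htm.symm) (e2.trans htm.symm) with h | ⟨h, h'⟩
    · exact hivt s₁ s₂ hs₁ hs₂ h12 (fun s hs => (h s hs).trans htm) hx'
    -- The arc wraps around here, so it is split at the common endpoint $Z(0)=Z(1)$.
    · rcases uIcc_subset_uIcc_union_uIcc
        (b := height (c - Real.pi / 2) (angleCurve q 0)) hx' with h2 | h2
      · exact hivt 0 s₁ h0 hs₁ hs₁.1 (fun s hs => (h s hs).trans htm) (by rwa [uIcc_comm])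
      · rw [angleCurve_zero, ← hq.angleCurve_one] at h2
        exact hivt s₂ 1 hs₂ h1 hs₂.2 (fun s hs => (h' s hs).trans htm) (by rwa [uIcc_comm])
  rintro _ ⟨⟨s₁, hs₁, rfl⟩, e1⟩ _ ⟨⟨s₂, hs₂, rfl⟩, e2⟩
  rcases le_total s₁ s₂ with h | h
  · exact key s₁ hs₁ s₂ hs₂ h e1 e2
  · rw [segment_symm]
    exact key s₂ hs₂ s₁ hs₁ h e2 e1

theorem ccsBoundary_convexHull_of_interior_nonempty (hq : IsAngle q)
    (hint : (interior (convexHull ℝ (angleCurve q '' Icc 0 1))).Nonempty) :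
    ccsBoundary (convexHull ℝ (angleCurve q '' Icc 0 1)) = angleCurve q '' Icc 0 1 := by
  apply Subset.antisymm
  · rintro p ⟨hp, hpint⟩
    obtain ⟨f, hf0, hf⟩ := geometric_hahn_banach_of_nonempty_interior_point
      (convex_convexHull ℝ _) hpint hint
    -- The supporting functional is maximal at `p`; its negative is a height that is minimal there.
    obtain ⟨r, hr, c, hc, hfc⟩ := exists_eq_smul_height (-f)
    have hr0 : 0 < r := by
      refine hr.lt_of_ne' fun h => hf0 ?_
      rw [h, zero_smul] at hfc
      exact neg_eq_zero.1 hfc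
    have hmin : ∀ a ∈ convexHull ℝ (angleCurve q '' Icc 0 1), height c p ≤ height c a := by
      intro a ha
      have h1 := DFunLike.congr_fun hfc p
      have h2 := DFunLike.congr_fun hfc a
      simp only [neg_apply, smul_apply, smul_eq_mul] at h1 h2
      have h3 := hf a ha
      exact le_of_mul_le_mul_left (by linarith) hr0
    have hmem := mem_convexHull_inter_of_forall_le hp
      fun a ha => hmin a (subset_convexHull ℝ _ ha)
    rw [(hq.convex_curve_inter_height hc fun s hs =>
      hmin _ (subset_convexHull ℝ _ (mem_image_of_mem _ hs))).convexHull_eq] at hmem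
    exact hmem.1
  · rintro _ ⟨s, hs, rfl⟩
    exact hq.angleCurve_mem_ccsBoundary hs

/-! ### Degenerate curves. -/

/-- A curve contained in a line runs once forth and back along a segment. -/
theorem angleCurve_eq_of_height_eq_zero (hq : IsAngle q) {c : ℝ} (hc : c ∈ Ico 0 Real.pi)
    (h : ∀ s ∈ Icc (0 : ℝ) 1, height c (angleCurve q s) = 0) :
    (∀ t ∈ Icc (0 : ℝ) (1 / 2), angleCurve q t = (t : ℂ) * Complex.exp (Complex.I * c)) ∧
      ∀ t ∈ Icc (1 / 2 : ℝ) 1, angleCurve q t = (1 - t : ℂ) * Complex.exp (Complex.I * c) := by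
  have hpi := Real.pi_pos
  have hconst : ∀ a b : ℝ, 0 ≤ a → a ≤ b → b ≤ 1 → (∀ u ∈ Ioo a b, 0 < Real.sin (q u - c)) →
      a = b := by
    intro a b ha hab hb hpos
    by_contra hne
    have := hq.height_angleCurve_lt ha (hab.lt_of_ne hne) hb hpos
    rw [h a ⟨ha, hab.trans hb⟩, h b ⟨ha.trans hab, hb⟩] at this
    exact lt_irrefl _ this
  have hconst' : ∀ a b : ℝ, 0 ≤ a → a ≤ b → b ≤ 1 → (∀ u ∈ Ioo a b, Real.sin (q u - c) < 0) →
      a = b := by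
    intro a b ha hab hb hneg
    by_contra hne
    have := hq.height_angleCurve_gt ha (hab.lt_of_ne hne) hb hneg
    rw [h a ⟨ha, hab.trans hb⟩, h b ⟨ha.trans hab, hb⟩] at this
    exact lt_irrefl _ this
  -- Angles below $c$ or above $c+\pi$ on an interval of positive length would make the height fall
  -- strictly, and angles strictly between would make it rise. Hence `q` takes only the values $c$
  -- and $c+\pi$ on the open parameter interval.
  have hbelow : ∀ u ∈ Ioc (0 : ℝ) 1, c ≤ q u := by
    obtain ⟨t, ht, hlt, hge⟩ := hq.exists_crossing (P := fun x => x < c)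
      fun x y hxy hy => hxy.trans_lt hy
    have h0 : 0 = t := hconst' 0 t le_rfl ht.1 ht.2 fun u hu =>
      Real.sin_neg_of_neg_of_neg_pi_lt (by linarith [hlt u ⟨hu.1.le, hu.2⟩])
        (by linarith [hq.nonneg u ⟨hu.1.le, hu.2.le.trans ht.2⟩, hc.2])
    subst h0
    exact fun u hu => not_lt.1 (hge u hu)
  have habove : ∀ u ∈ Ico (0 : ℝ) 1, q u ≤ c + Real.pi := by
    obtain ⟨t, ht, hle, hgt⟩ := hq.exists_crossing (P := fun x => x ≤ c + Real.pi)
      fun x y hxy hy => hxy.trans hy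
    have h1 : t = 1 := hconst' t 1 ht.1 ht.2 le_rfl fun u hu => by
      rw [← Real.sin_sub_two_pi]
      exact Real.sin_neg_of_neg_of_neg_pi_lt
        (by linarith [hq.lt_two_pi u ⟨ht.1.trans hu.1.le, hu.2⟩, hc.1])
        (by linarith [not_le.1 (hgt u ⟨hu.1, hu.2.le⟩)])
    subst h1
    exact hle
  obtain ⟨T, hT, hle, hgt⟩ := hq.exists_crossing (P := fun x => x ≤ c)
    fun x y hxy hy => hxy.trans hy
  obtain ⟨W, hW, hlt, hge⟩ := hq.exists_crossing (P := fun x => x < c + Real.pi)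
    fun x y hxy hy => hxy.trans_lt hy
  have hTW : T = max T W := hconst T _ hT.1 (le_max_left _ _) (max_le hT.2 hW.2) fun u hu => by
    have huW : u < W := (lt_max_iff.1 hu.2).resolve_left (not_lt.2 hu.1.le)
    exact Real.sin_pos_of_pos_of_lt_pi
      (by linarith [not_le.1 (hgt u ⟨hu.1, huW.le.trans hW.2⟩)])
      (by linarith [hlt u ⟨hT.1.trans hu.1.le, huW⟩])
  have hWT : W ≤ T := by rw [hTW]; exact le_max_right _ _
  have h0 : (0 : ℝ) ∈ Icc (0 : ℝ) 1 := ⟨le_rfl, zero_le_one⟩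
  have h1 : (1 : ℝ) ∈ Icc (0 : ℝ) 1 := ⟨zero_le_one, le_rfl⟩
  have hfirst : ∀ t ∈ Icc (0 : ℝ) T,
      angleCurve q t = (t : ℂ) * Complex.exp (Complex.I * c) := by
    intro t ht
    have : angleCurve q t = ∫ u in (0 : ℝ)..t, Complex.exp (Complex.I * c) := by
      unfold angleCurve
      rw [intervalIntegral.integral_of_le ht.1, intervalIntegral.integral_of_le ht.1,
        integral_Ioc_eq_integral_Ioo, integral_Ioc_eq_integral_Ioo]
      refine setIntegral_congr_fun measurableSet_Ioo fun u hu => ?_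
      have : q u = c := (hle u ⟨hu.1.le, hu.2.trans_le ht.2⟩).antisymm
        (hbelow u ⟨hu.1, hu.2.le.trans (ht.2.trans hT.2)⟩)
      simp only [this]
    rw [this]
    simp
  have hsecond : ∀ t ∈ Icc T (1 : ℝ),
      angleCurve q t = (1 - t : ℂ) * Complex.exp (Complex.I * c) := by
    intro t ht
    have h2 : angleCurve q 1 - angleCurve q t =
        ∫ u in t..(1 : ℝ), -Complex.exp (Complex.I * c) := by
      rw [hq.angleCurve_sub ⟨hT.1.trans ht.1, ht.2⟩ h1, intervalIntegral.integral_of_le ht.2,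
        intervalIntegral.integral_of_le ht.2, integral_Ioc_eq_integral_Ioo,
        integral_Ioc_eq_integral_Ioo]
      refine setIntegral_congr_fun measurableSet_Ioo fun u hu => ?_
      have hTu : T < u := ht.1.trans_lt hu.1
      have : q u = c + Real.pi := (habove u ⟨hT.1.trans hTu.le, hu.2⟩).antisymm
        (not_lt.1 (hge u ⟨hWT.trans_lt hTu, hu.2.le⟩))
      simp only [this]
      push_cast
      rw [mul_add, Complex.exp_add, mul_comm Complex.I (Real.pi : ℂ), Complex.exp_pi_mul_I]
      ring
    rw [hq.angleCurve_one] at h2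
    simp at h2
    exact h2
  -- The outward and return formulas must agree at the turning point.
  have hThalf : T = 1 / 2 := by
    have h2 := (hfirst T ⟨hT.1, le_rfl⟩).symm.trans (hsecond T ⟨le_rfl, hT.2⟩)
    have h3 := mul_right_cancel₀ (Complex.exp_ne_zero _) h2
    have h4 : T = 1 - T := by exact_mod_cast h3
    linarith
  subst hThalf
  exact ⟨hfirst, hsecond⟩

theorem image_angleCurve_eq_segment (hq : IsAngle q) {c : ℝ} (hc : c ∈ Ico 0 Real.pi)
    (h : ∀ s ∈ Icc (0 : ℝ) 1, height c (angleCurve q s) = 0) :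
    angleCurve q '' Icc 0 1 = segment ℝ 0 ((1 / 2 : ℝ) • Complex.exp (Complex.I * c)) := by
  obtain ⟨h1, h2⟩ := hq.angleCurve_eq_of_height_eq_zero hc h
  rw [segment_eq_image']
  apply Subset.antisymm
  · rintro _ ⟨t, ht, rfl⟩
    rcases le_total t (1 / 2) with h | h
    · refine ⟨2 * t, ⟨by linarith [ht.1], by linarith⟩, ?_⟩
      rw [h1 t ⟨ht.1, h⟩]
      simp only [Complex.real_smul]
      push_cast
      ring
    · refine ⟨2 * (1 - t), ⟨by linarith [ht.2], by linarith⟩, ?_⟩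
      rw [h2 t ⟨h, ht.2⟩]
      simp only [Complex.real_smul]
      push_cast
      ring
  · rintro _ ⟨t, ht, rfl⟩
    refine ⟨t / 2, ⟨by linarith [ht.1], by linarith [ht.2]⟩, ?_⟩
    rw [h1 _ ⟨by linarith [ht.1], by linarith [ht.2]⟩]
    simp only [Complex.real_smul]
    push_cast
    ring

theorem exists_image_angleCurve_eq_segment (hq : IsAngle q)
    (hint : interior (convexHull ℝ (angleCurve q '' Icc 0 1)) = ∅) :
    ∃ c : ℝ, angleCurve q '' Icc 0 1 =
      segment ℝ 0 ((1 / 2 : ℝ) • Complex.exp (Complex.I * c)) := by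
  obtain ⟨c, hc, h⟩ := exists_height_eq_zero_of_interior_eq_empty
    (A := angleCurve q '' Icc 0 1) ⟨0, ⟨le_rfl, zero_le_one⟩, angleCurve_zero q⟩ hint
  exact ⟨c, hq.image_angleCurve_eq_segment hc fun s hs => h _ (mem_image_of_mem _ hs)⟩

theorem ccsBoundary_convexHull (hq : IsAngle q) :
    ccsBoundary (convexHull ℝ (angleCurve q '' Icc 0 1)) = angleCurve q '' Icc 0 1 := by
  rcases (interior (convexHull ℝ (angleCurve q '' Icc 0 1))).eq_empty_or_nonempty with h | h
  · obtain ⟨c, hc⟩ := hq.exists_image_angleCurve_eq_segment h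
    have hconv : Convex ℝ (angleCurve q '' Icc 0 1) := hc ▸ convex_segment _ _
    rw [ccsBoundary, h, sdiff_empty, hconv.convexHull_eq]
  · exact hq.ccsBoundary_convexHull_of_interior_nonempty h

/-! ### Simplicity, arc length and perimeter. -/

/-- A double point would close the arc from $s_1$ to $s_2$ and also the complementary one. If the
angle grows by less than $\pi$ between them, the middle arc moves strictly in its bisecting
direction. If by more than $\pi$, the complementary arc does, modulo $2\pi$. If by exactly $\pi$,
all heights in direction $q(s_1)$ vanish and the hull has no interior. -/
theorem angleCurve_ne (hq : IsAngle q)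
    (hint : (interior (convexHull ℝ (angleCurve q '' Icc 0 1))).Nonempty) {s₁ s₂ : ℝ}
    (h0 : 0 ≤ s₁) (h12 : s₁ < s₂) (h1 : s₂ < 1) : angleCurve q s₁ ≠ angleCurve q s₂ := by
  intro heq
  have hs₁ : s₁ ∈ Icc (0 : ℝ) 1 := ⟨h0, (h12.trans h1).le⟩
  have hs₂ : s₂ ∈ Icc (0 : ℝ) 1 := ⟨h0.trans h12.le, h1.le⟩
  have hpi := Real.pi_pos
  have hα : 0 ≤ q s₁ := hq.nonneg _ hs₁
  have hβ : q s₂ < 2 * Real.pi := hq.lt_two_pi _ ⟨hs₂.1, h1⟩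
  have hfst : ∀ u ∈ Ioo 0 s₁, 0 ≤ q u ∧ q u ≤ q s₁ := fun u hu =>
    have hu' : u ∈ Icc (0 : ℝ) 1 := ⟨hu.1.le, hu.2.le.trans hs₁.2⟩
    ⟨hq.nonneg u hu', hq.monotoneOn hu' hs₁ hu.2.le⟩
  have hmid : ∀ u ∈ Ioo s₁ s₂, q s₁ ≤ q u ∧ q u ≤ q s₂ := fun u hu =>
    have hu' : u ∈ Icc (0 : ℝ) 1 := ⟨h0.trans hu.1.le, hu.2.le.trans hs₂.2⟩
    ⟨hq.monotoneOn hs₁ hu' hu.1.le, hq.monotoneOn hu' hs₂ hu.2.le⟩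
  have hlst : ∀ u ∈ Ioo s₂ 1, q s₂ ≤ q u ∧ q u < 2 * Real.pi := fun u hu =>
    have hu' : u ∈ Icc (0 : ℝ) 1 := ⟨hs₂.1.trans hu.1.le, hu.2.le⟩
    ⟨hq.monotoneOn hs₂ hu' hu.1.le, hq.lt_two_pi u ⟨hu'.1, hu.2⟩⟩
  have hZ0 : ∀ c, height c (angleCurve q 0) = 0 := fun c => by rw [angleCurve_zero, map_zero]
  have hZ1 : ∀ c, height c (angleCurve q 1) = 0 := fun c => by rw [hq.angleCurve_one, map_zero]
  rcases lt_trichotomy (q s₂ - q s₁) Real.pi with hlt | hlt | hlt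
  · have := hq.height_angleCurve_lt (c := (q s₁ + q s₂) / 2 - Real.pi / 2) h0 h12 h1.le
      fun u hu => Real.sin_pos_of_pos_of_lt_pi (by linarith [(hmid u hu).1])
        (by linarith [(hmid u hu).2])
    rw [heq] at this
    exact lt_irrefl _ this
  · have e1 := hq.monotoneOn_height (c := q s₁) h0 h1.le fun u hu =>
      Real.sin_nonneg_of_nonneg_of_le_pi (by linarith [(hmid u hu).1])
        (by linarith [(hmid u hu).2])
    have e2 := hq.antitoneOn_height (c := q s₁) le_rfl hs₁.2 fun u hu =>
      Real.sin_nonpos_of_nonpos_of_neg_pi_le (by linarith [(hfst u hu).2])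
        (by linarith [(hfst u hu).1])
    have e3 := hq.antitoneOn_height (c := q s₁) hs₂.1 le_rfl fun u hu => by
      rw [← Real.sin_sub_two_pi]
      exact Real.sin_nonpos_of_nonpos_of_neg_pi_le (by linarith [(hlst u hu).2])
        (by linarith [(hlst u hu).1])
    have a0 := hZ0 (q s₁)
    have a1 := hZ1 (q s₁)
    have b1 := e2 ⟨le_rfl, h0⟩ ⟨h0, le_rfl⟩ h0
    have b2 := e3 ⟨le_rfl, hs₂.2⟩ ⟨hs₂.2, le_rfl⟩ hs₂.2
    have b3 : height (q s₁) (angleCurve q s₁) = height (q s₁) (angleCurve q s₂) := by rw [heq]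
    simp only at b1 b2
    have hzero : ∀ s ∈ Icc (0 : ℝ) 1, height (q s₁) (angleCurve q s) = 0 := by
      intro s hs
      rcases le_total s s₁ with h | h
      · have c1 := e2 ⟨le_rfl, h0⟩ ⟨hs.1, h⟩ hs.1
        have c2 := e2 ⟨hs.1, h⟩ ⟨h0, le_rfl⟩ h
        simp only at c1 c2
        linarith
      rcases le_total s s₂ with h' | h'
      · have c1 := e1 ⟨le_rfl, h12.le⟩ ⟨h, h'⟩ h
        have c2 := e1 ⟨h, h'⟩ ⟨h12.le, le_rfl⟩ h'
        simp only at c1 c2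
        linarith
      · have c1 := e3 ⟨le_rfl, hs₂.2⟩ ⟨h', hs.2⟩ h'
        have c2 := e3 ⟨h', hs.2⟩ ⟨hs₂.2, le_rfl⟩ hs.2
        simp only at c1 c2
        linarith
    have hsub : convexHull ℝ (angleCurve q '' Icc 0 1) ⊆ {z | height (q s₁) z = 0} := by
      refine convexHull_min ?_ (convex_hyperplane (height (q s₁)).toLinearMap.isLinear 0)
      rintro _ ⟨s, hs, rfl⟩
      exact hzero s hs
    rw [interior_eq_empty_of_height_eq_zero hsub] at hint
    exact not_nonempty_empty hint
  · have e1 := hq.height_angleCurve_le (c := (q s₁ + q s₂) / 2 + Real.pi / 2) le_rfl h0 hs₁.2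
      fun u hu => by
        rw [← Real.sin_add_two_pi]
        exact Real.sin_nonneg_of_nonneg_of_le_pi (by linarith [(hfst u hu).1])
          (by linarith [(hfst u hu).2])
    have e2 := hq.height_angleCurve_lt (c := (q s₁ + q s₂) / 2 + Real.pi / 2) hs₂.1 h1 le_rfl
      fun u hu => Real.sin_pos_of_pos_of_lt_pi (by linarith [(hlst u hu).1])
        (by linarith [(hlst u hu).2])
    rw [hZ0] at e1
    rw [hZ1, ← heq] at e2
    linarith

theorem injOn_angleCurve (hq : IsAngle q)
    (hint : (interior (convexHull ℝ (angleCurve q '' Icc 0 1))).Nonempty) :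
    InjOn (angleCurve q) (Ico 0 1) := by
  intro s₁ hs₁ s₂ hs₂ heq
  rcases lt_trichotomy s₁ s₂ with h | h | h
  · exact absurd heq (hq.angleCurve_ne hint hs₁.1 h hs₂.2)
  · exact h
  · exact absurd heq.symm (hq.angleCurve_ne hint hs₂.1 h hs₁.2)

/-- The curve is cut where `q` passes multiples of $\delta$. On one piece the tangents stay within
angle $\delta$ of a fixed direction, so the chord is at least $\cos\delta$ times the parameter
length; the pieces are added by induction on `k`. -/
theorem ofReal_cos_mul_le_eVariationOn (hq : IsAngle q) {δ : ℝ} (hδ0 : 0 ≤ δ)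
    (hδ : δ ≤ Real.pi / 2) (k : ℕ) :
    ∀ s ∈ Icc (0 : ℝ) 1, (∀ u ∈ Ico 0 s, q u < k * δ) →
      ENNReal.ofReal (Real.cos δ * s) ≤ eVariationOn (angleCurve q) (Icc 0 s) := by
  have hcos : 0 ≤ Real.cos δ :=
    Real.cos_nonneg_of_neg_pi_div_two_le_of_le (by linarith [Real.pi_pos]) hδ
  induction k with
  | zero =>
    intro s hs h
    have : s = 0 := by
      by_contra hne
      have h0 : (0 : ℝ) < s := hs.1.lt_of_ne' hne
      have := h 0 ⟨le_rfl, h0⟩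
      have := hq.nonneg 0 ⟨le_rfl, zero_le_one⟩
      simp only [Nat.cast_zero, zero_mul] at *
      linarith
    simp [this]
  | succ k ih =>
    intro s hs h
    obtain ⟨t, ht, hlt, hge⟩ := hq.exists_crossing (P := fun x => x < k * δ)
      fun x y hxy hy => hxy.trans_lt hy
    set r := min t s
    have hr : r ∈ Icc (0 : ℝ) 1 := ⟨le_min ht.1 hs.1, (min_le_right _ _).trans hs.2⟩
    have hrs : r ≤ s := min_le_right _ _
    have h1 := ih r hr fun u hu => hlt u ⟨hu.1, hu.2.trans_le (min_le_left _ _)⟩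
    have h2 : Real.cos δ * (s - r) ≤ dist (angleCurve q r) (angleCurve q s) := by
      -- The height in direction $k\delta-\pi/2$ is the projection onto the direction $k\delta$.
      have hsub := hq.height_angleCurve_sub (k * δ - Real.pi / 2) hr hs
      have hle : ∫ u in r..s, Real.cos δ ≤ ∫ u in r..s, Real.sin (q u - (k * δ - Real.pi / 2)) := by
        rw [intervalIntegral.integral_of_le hrs, intervalIntegral.integral_of_le hrs,
          integral_Ioc_eq_integral_Ioo, integral_Ioc_eq_integral_Ioo]
        refine setIntegral_mono_on (by simp) ?_ measurableSet_Ioo fun u hu => ?_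
        · exact (intervalIntegrable_iff_integrableOn_Ioo_of_le hrs).1
            (hq.intervalIntegrable_sin _ hr hs)
        · have hu1 : t < u := (min_lt_iff.1 hu.1).resolve_right (not_lt.2 hu.2.le)
          have hge' := not_lt.1 (hge u ⟨hu1, hu.2.le.trans hs.2⟩)
          have hlt' := h u ⟨hr.1.trans hu.1.le, hu.2⟩
          push_cast at hlt'
          rw [show q u - (k * δ - Real.pi / 2) = (q u - k * δ) + Real.pi / 2 by ring,
            Real.sin_add_pi_div_two]
          exact Real.cos_le_cos_of_nonneg_of_le_pi (by linarith) (by linarith [Real.pi_pos])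
            (by linarith)
      rw [intervalIntegral.integral_const, smul_eq_mul, ← hsub, ← map_sub] at hle
      rw [dist_comm, dist_eq_norm]
      linarith [(le_abs_self _).trans (abs_height_le (k * δ - Real.pi / 2)
        (angleCurve q s - angleCurve q r))]
    have h3 : ENNReal.ofReal (Real.cos δ * (s - r)) ≤ eVariationOn (angleCurve q) (Icc r s) := by
      refine le_trans ?_ (eVariationOn.edist_le (angleCurve q) (left_mem_Icc.2 hrs)
        (right_mem_Icc.2 hrs))
      rw [edist_dist]
      exact ENNReal.ofReal_le_ofReal h2
    have h4 := eVariationOn.Icc_add_Icc (angleCurve q) (s := univ) hr.1 hrs (mem_univ _)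
    simp only [univ_inter] at h4
    rw [← h4, show Real.cos δ * s = Real.cos δ * r + Real.cos δ * (s - r) by ring,
      ENNReal.ofReal_add (mul_nonneg hcos hr.1) (mul_nonneg hcos (sub_nonneg.2 hrs))]
    exact add_le_add h1 h3

theorem eVariationOn_angleCurve (hq : IsAngle q) {s : ℝ} (hs : s ∈ Icc (0 : ℝ) 1) :
    eVariationOn (angleCurve q) (Icc 0 s) = ENNReal.ofReal s := by
  apply le_antisymm
  · have h := (hq.lipschitzOnWith_angleCurve.mono
      (Icc_subset_Icc_right hs.2)).comp_eVariationOn_le (g := id) (s := Icc 0 s) fun x hx => hx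
    have h2 : eVariationOn (id : ℝ → ℝ) (Icc 0 s) ≤ ENNReal.ofReal (id s - id 0) := by
      have := (monotone_id (α := ℝ)).monotoneOn (Icc 0 s) |>.eVariationOn_eq
        (left_mem_Icc.2 hs.1) (right_mem_Icc.2 hs.1)
      rw [inter_self] at this
      exact this.le
    simp only [Function.comp_id, ENNReal.coe_one, one_mul, id, sub_zero] at h h2
    exact h.trans h2
  -- The chord bound holds for each small $\delta$ once $k\delta>2\pi$; then $\delta\to0$.
  · have hev : ∀ᶠ δ in nhdsWithin (0 : ℝ) (Ioi 0),
        ENNReal.ofReal (Real.cos δ * s) ≤ eVariationOn (angleCurve q) (Icc 0 s) := by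
      filter_upwards [Ioo_mem_nhdsGT (show (0 : ℝ) < Real.pi / 2 by positivity)] with δ hδ
      obtain ⟨k, hk⟩ := exists_nat_gt (2 * Real.pi / δ)
      rw [div_lt_iff₀ hδ.1] at hk
      exact hq.ofReal_cos_mul_le_eVariationOn hδ.1.le hδ.2.le k s hs fun u hu =>
        (hq.lt_two_pi u ⟨hu.1, hu.2.trans_le hs.2⟩).trans hk
    have hlim : Filter.Tendsto (fun δ => ENNReal.ofReal (Real.cos δ * s))
        (nhdsWithin (0 : ℝ) (Ioi 0)) (nhds (ENNReal.ofReal (Real.cos 0 * s))) := by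
      refine Filter.Tendsto.mono_left (Continuous.tendsto ?_ 0) nhdsWithin_le_nhds
      exact ENNReal.continuous_ofReal.comp (by fun_prop)
    rw [Real.cos_zero, one_mul] at hlim
    exact le_of_tendsto hlim hev

theorem isNaturalParam_angleCurve (hq : IsAngle q)
    (hint : (interior (convexHull ℝ (angleCurve q '' Icc 0 1))).Nonempty) :
    IsNaturalParam (convexHull ℝ (angleCurve q '' Icc 0 1)) 1 (angleCurve q) :=
  ⟨hq.continuousOn_angleCurve, hq.injOn_angleCurve hint,
    by rw [angleCurve_zero, hq.angleCurve_one], hq.ccsBoundary_convexHull.symm,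
    fun _ hs => hq.eVariationOn_angleCurve hs⟩

theorem hasPerimeter_convexHull (hq : IsAngle q) :
    HasPerimeter (convexHull ℝ (angleCurve q '' Icc 0 1)) 1 := by
  rcases (interior (convexHull ℝ (angleCurve q '' Icc 0 1))).eq_empty_or_nonempty with h | h
  · obtain ⟨c, hc⟩ := hq.exists_image_angleCurve_eq_segment h
    have hconv : Convex ℝ (angleCurve q '' Icc 0 1) := hc ▸ convex_segment _ _
    refine Or.inr ⟨_, _, hconv.convexHull_eq.trans hc, ?_⟩
    rw [sub_zero, norm_smul, mul_comm Complex.I, Complex.norm_exp_ofReal_mul_I]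
    norm_num
  · exact Or.inl ⟨h, one_pos, _, hq.isNaturalParam_angleCurve h⟩

/-! ### Position relative to the real axis. -/

theorem angleCurve_im_nonneg (hq : IsAngle q) {s : ℝ} (hs : s ∈ Icc (0 : ℝ) 1) :
    0 ≤ (angleCurve q s).im := by
  have h := (hq.isCyclicMin_height (c := 0) (t := 0) ⟨le_rfl, by positivity⟩
    ⟨le_rfl, zero_le_one⟩ (fun u hu => absurd (hu.1.trans hu.2) (lt_irrefl _))
    fun u hu => hq.nonneg u ⟨hu.1.le, hu.2.le⟩).1 s hs
  simpa [angleCurve_zero, height_apply] using h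

/-- The curve runs along the positive axis while $q=0$, its imaginary part rises strictly while
$0<q<\pi$, and it does not rise afterwards. It can return to the axis before parameter 1 only if the
rising phase is absent, in which case the whole curve is a segment on that axis. -/
theorem angleCurve_re_nonneg (hq : IsAngle q) {s : ℝ} (hs : s ∈ Icc (0 : ℝ) 1)
    (him : (angleCurve q s).im = 0) : 0 ≤ (angleCurve q s).re := by
  have hpi := Real.pi_pos
  have hheight : ∀ z, height 0 z = z.im := fun z => by simp [height_apply]
  have h0 : (angleCurve q 0).im = 0 := by simp [angleCurve_zero]
  have h1 : (angleCurve q 1).im = 0 := by simp [hq.angleCurve_one]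
  have hdeg : (∀ r ∈ Icc (0 : ℝ) 1, (angleCurve q r).im = 0) → 0 ≤ (angleCurve q s).re := by
    intro h
    have := hq.image_angleCurve_eq_segment (c := 0) ⟨le_rfl, hpi⟩ fun r hr => by
      rw [hheight, h r hr]
    have hmem := mem_image_of_mem (angleCurve q) hs
    rw [this, segment_eq_image'] at hmem
    obtain ⟨t, ht, hts⟩ := hmem
    rw [← hts]
    have := ht.1
    simp
    positivity
  rcases hs.2.lt_or_eq with hs1 | rfl
  swap
  · simp [hq.angleCurve_one]
  obtain ⟨t, ht, hle, hgt⟩ := hq.exists_crossing (P := fun x => x ≤ 0)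
    fun x y hxy hy => hxy.trans hy
  rcases le_or_gt s t with hst | hts
  · have h2 := hq.height_angleCurve_le (c := -(Real.pi / 2)) le_rfl hs.1 hs.2 fun u hu => by
      have : q u = 0 := (hle u ⟨hu.1.le, hu.2.trans_le hst⟩).antisymm
        (hq.nonneg u ⟨hu.1.le, hu.2.le.trans hs.2⟩)
      simp [this]
    simpa [height_apply, angleCurve_zero] using h2
  · obtain ⟨w, hw, hlt, hge⟩ := hq.exists_crossing (P := fun x => x < Real.pi)
      fun x y hxy hy => hxy.trans_lt hy
    have hzero_t : (angleCurve q t).im = 0 := by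
      have h2 := hq.antitoneOn_height (c := 0) le_rfl ht.2 fun u hu => by
        have : q u = 0 := (hle u ⟨hu.1.le, hu.2⟩).antisymm
          (hq.nonneg u ⟨hu.1.le, hu.2.le.trans ht.2⟩)
        simp [this]
      have h3 := h2 ⟨le_rfl, ht.1⟩ ⟨ht.1, le_rfl⟩ ht.1
      simp only [hheight, h0] at h3
      exact h3.antisymm (hq.angleCurve_im_nonneg ht)
    have hdown : ∀ a b : ℝ, max t w ≤ a → a ≤ b → b ≤ 1 →
        (angleCurve q b).im ≤ (angleCurve q a).im := by
      intro a b ha hab hb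
      have h2 := hq.antitoneOn_height (c := 0) ((ht.1.trans (le_max_left t w)).trans ha) hb
        fun u hu => by
          have hu1 : u < 1 := hu.2.trans_le hb
          have hwu : w < u := ((le_max_right t w).trans ha).trans_lt hu.1
          have h3 := not_lt.1 (hge u ⟨hwu, hu1.le⟩)
          have h4 := hq.lt_two_pi u ⟨hw.1.trans hwu.le, hu1⟩
          rw [← Real.sin_sub_two_pi]
          exact Real.sin_nonpos_of_nonpos_of_neg_pi_le (by linarith) (by linarith)
      simpa only [hheight] using h2 ⟨le_rfl, hab⟩ ⟨hab, le_rfl⟩ hab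
    rcases le_or_gt w t with hwt | htw
    · have hmax : max t w = t := max_eq_left hwt
      rw [hmax] at hdown
      apply hdeg
      intro r hr
      rcases le_total r t with h | h
      · have h2 := hq.antitoneOn_height (c := 0) le_rfl ht.2 fun u hu => by
          have : q u = 0 := (hle u ⟨hu.1.le, hu.2⟩).antisymm
            (hq.nonneg u ⟨hu.1.le, hu.2.le.trans ht.2⟩)
          simp [this]
        have h3 := h2 ⟨le_rfl, ht.1⟩ ⟨hr.1, h⟩ hr.1
        simp only [hheight, h0] at h3
        exact h3.antisymm (hq.angleCurve_im_nonneg hr)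
      · exact ((hdown t r le_rfl h hr.2).trans hzero_t.le).antisymm (hq.angleCurve_im_nonneg hr)
    · exfalso
      have hup : ∀ b : ℝ, t < b → b ≤ w → 0 < (angleCurve q b).im := by
        intro b htb hbw
        have h2 := hq.height_angleCurve_lt (c := 0) ht.1 htb (hbw.trans hw.2) fun u hu => by
          rw [sub_zero]
          exact Real.sin_pos_of_pos_of_lt_pi
            (not_le.1 (hgt u ⟨hu.1, hu.2.le.trans (hbw.trans hw.2)⟩))
            (hlt u ⟨ht.1.trans hu.1.le, hu.2.trans_le hbw⟩)
        rwa [hheight, hheight, hzero_t] at h2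
      rcases le_or_gt s w with hsw | hws
      · exact (hup s hts hsw).ne' him
      -- If angles above $\pi$ occur, the final strict descent to 0 shows that the imaginary part
      -- was still positive after $s$. If they do not, it never descends from its positive value at
      -- $w$.
      · obtain ⟨x, hx, hxle, hxgt⟩ := hq.exists_crossing (P := fun y => y ≤ Real.pi)
          fun a b hab hb => hab.trans hb
        rcases hx.2.lt_or_eq with hx1 | rfl
        · have h2 := hq.height_angleCurve_gt (c := 0) (hx.1.trans (le_max_left x s))
            (max_lt hx1 hs1) le_rfl fun u hu => by
              have hxu : x < u := (le_max_left x s).trans_lt hu.1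
              have h3 := not_le.1 (hxgt u ⟨hxu, hu.2.le⟩)
              have h4 := hq.lt_two_pi u ⟨hx.1.trans hxu.le, hu.2⟩
              rw [← Real.sin_sub_two_pi]
              exact Real.sin_neg_of_neg_of_neg_pi_lt (by linarith) (by linarith)
          have h5 := hdown s (max x s) (max_le hts.le hws.le) (le_max_right _ _)
            (max_lt hx1 hs1).le
          rw [hheight, hheight, h1] at h2
          linarith
        · have h2 := hq.height_angleCurve_le (c := 0) hw.1 hw.2 le_rfl fun u hu => by
            rw [sub_zero]
            exact Real.sin_nonneg_of_nonneg_of_le_pi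
              (hq.nonneg u ⟨hw.1.trans hu.1.le, hu.2.le⟩) (hxle u ⟨hw.1.trans hu.1.le, hu.2⟩)
          rw [hheight, hheight, h1] at h2
          linarith [hup w htw le_rfl]

theorem convexHull_mem_convOne (hq : IsAngle q) :
    convexHull ℝ (angleCurve q '' Icc 0 1) ∈ convOne := by
  have h0 : (0 : ℂ) ∈ convexHull ℝ (angleCurve q '' Icc 0 1) :=
    subset_convexHull ℝ _ ⟨0, ⟨le_rfl, zero_le_one⟩, angleCurve_zero q⟩
  -- A combination with positive weights is real only if both points are.
  have hconv : Convex ℝ {z : ℂ | 0 ≤ z.im ∧ (z.im = 0 → 0 ≤ z.re)} := by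
    rw [convex_iff_forall_pos]
    rintro x ⟨hx, hx'⟩ y ⟨hy, hy'⟩ a b ha hb -
    have hax := mul_nonneg ha.le hx
    have hby := mul_nonneg hb.le hy
    simp only [Complex.real_smul, mem_ofPred_eq, Complex.add_im, Complex.add_re,
      Complex.re_ofReal_mul, Complex.im_ofReal_mul]
    refine ⟨add_nonneg hax hby, fun h => ?_⟩
    have h1 : x.im = 0 := (mul_eq_zero.1 (by linarith : a * x.im = 0)).resolve_left ha.ne'
    have h2 : y.im = 0 := (mul_eq_zero.1 (by linarith : b * y.im = 0)).resolve_left hb.ne'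
    exact add_nonneg (mul_nonneg ha.le (hx' h1)) (mul_nonneg hb.le (hy' h2))
  have hsub := convexHull_min (by
    rintro _ ⟨s, hs, rfl⟩
    exact ⟨hq.angleCurve_im_nonneg hs, hq.angleCurve_re_nonneg hs⟩) hconv
      (s := angleCurve q '' Icc 0 1)
  exact ⟨⟨⟨0, h0⟩, hq.isCompact_convexHull, convex_convexHull ℝ _⟩, h0, fun z hz => (hsub hz).1,
    fun z hz => (hsub hz).2, hq.hasPerimeter_convexHull⟩

/-! ### The support function of the hull. -/

/-- The support function of the convex set bounded by the curve. -/
theorem isLeast_height_convexHull (hq : IsAngle q) {c : ℝ} (hc : c ∈ Ico 0 (2 * Real.pi)) :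
    IsLeast (height c '' convexHull ℝ (angleCurve q '' Icc 0 1))
      (∫ u in Ioc (0 : ℝ) 1, (Iic c).indicator (fun x => Real.sin (x - c)) (q u)) := by
  obtain ⟨t, ht, hle, hgt⟩ := hq.exists_crossing (P := fun x => x ≤ c)
    fun x y hxy hy => hxy.trans hy
  have hmin := (hq.isCyclicMin_height hc ht (fun u hu => hle u ⟨hu.1.le, hu.2⟩)
    fun u hu => (not_le.1 (hgt u ⟨hu.1, hu.2.le⟩)).le).1
  -- The minimum is attained where `q` crosses `c`, so the indicator cuts the integral off at `t`;
  -- only the null set $\{t\}$ is undecided.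
  have hval : ∫ u in Ioc (0 : ℝ) 1, (Iic c).indicator (fun x => Real.sin (x - c)) (q u) =
      height c (angleCurve q t) := by
    have h := hq.height_angleCurve_sub c ⟨le_rfl, zero_le_one⟩ ht
    rw [angleCurve_zero, map_zero, sub_zero, intervalIntegral.integral_of_le ht.1,
      integral_Ioc_eq_integral_Ioo] at h
    have hinter : Ioc (0 : ℝ) 1 ∩ Ioo 0 t = Ioo 0 t :=
      inter_eq_right.2 fun u hu => ⟨hu.1, hu.2.le.trans ht.2⟩
    rw [h, ← hinter, ← setIntegral_indicator measurableSet_Ioo]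
    refine setIntegral_congr_ae measurableSet_Ioc ?_
    filter_upwards [compl_mem_ae_iff.2 (measure_singleton (μ := volume) t)] with u hut hu
    rcases lt_or_gt_of_ne hut with hlt | hgt'
    · rw [indicator_of_mem (show q u ∈ Iic c from hle u ⟨hu.1.le, hlt⟩),
        indicator_of_mem (show u ∈ Ioo 0 t from ⟨hu.1, hlt⟩)]
    · rw [indicator_of_notMem (show q u ∉ Iic c from hgt u ⟨hgt', hu.2⟩),
        indicator_of_notMem (show u ∉ Ioo 0 t from fun h => lt_asymm h.2 hgt')]
  rw [hval]
  apply isLeast_image_convexHull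
  refine ⟨mem_image_of_mem _ (mem_image_of_mem _ ht), ?_⟩
  rintro _ ⟨_, ⟨u, hu, rfl⟩, rfl⟩
  exact hmin u hu

end IsAngle

/-! ### Measures on the circle and their quantile functions. -/

instance fact_two_pi_pos : Fact (0 < 2 * Real.pi) := ⟨Real.two_pi_pos⟩

/-- The coordinate of a point of the circle in `[0, 2π)`. -/
noncomputable def torusAngle (θ : Torus) : ℝ := (AddCircle.equivIco (2 * Real.pi) 0 θ : ℝ)

theorem torusAngle_nonneg (θ : Torus) : 0 ≤ torusAngle θ :=
  (AddCircle.equivIco (2 * Real.pi) 0 θ).2.1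

theorem torusAngle_lt (θ : Torus) : torusAngle θ < 2 * Real.pi :=
  (AddCircle.equivIco (2 * Real.pi) 0 θ).2.2.trans_eq (zero_add _)

theorem coe_torusAngle (θ : Torus) : ((torusAngle θ : ℝ) : Torus) = θ :=
  AddCircle.coe_equivIco

theorem torusAngle_coe_le {y : ℝ} (hy : 0 ≤ y) : torusAngle (y : Torus) ≤ y := by
  rcases lt_or_ge y (2 * Real.pi) with h | h
  · exact (AddCircle.equivIco_coe_of_mem (p := 2 * Real.pi) (a := 0) ⟨hy, by simpa using h⟩).le
  · exact (torusAngle_lt _).le.trans h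

theorem measurable_torusAngle : Measurable torusAngle :=
  measurable_subtype_coe.comp (AddCircle.measurableEquivIco (2 * Real.pi) 0).measurable

theorem toCircle_eq_exp_torusAngle (θ : Torus) :
    ((AddCircle.toCircle θ : Circle) : ℂ) = Complex.exp (Complex.I * (torusAngle θ : ℂ)) := by
  conv_lhs => rw [← coe_torusAngle θ]
  rw [AddCircle.toCircle_apply_mk, div_self (by positivity), one_mul, Circle.coe_exp, mul_comm]

/-- Reducing a nonnegative number modulo $2\pi$ never increases it, so the arc is exactly the set of
points of angle at most $x$. Both sets are empty for $x<0$. -/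
theorem distFun_eq (μ : Measure Torus) (x : ℝ) :
    distFun μ x = (μ.map torusAngle).real (Iic x) := by
  rw [distFun, map_measureReal_apply measurable_torusAngle measurableSet_Iic]
  congr 1
  ext θ
  constructor
  · rintro ⟨y, hy, rfl⟩
    exact (torusAngle_coe_le hy.1).trans hy.2
  · exact fun h => ⟨torusAngle θ, ⟨torusAngle_nonneg θ, h⟩, coe_torusAngle θ⟩

theorem distFun_eq_zero {μ : Measure Torus} {x : ℝ} (hx : x < 0) : distFun μ x = 0 := by
  simp [distFun, Icc_eq_empty (not_le.2 hx)]

theorem quantile_nonneg {μ : Measure Torus} (u : ℝ) : 0 ≤ quantile μ u :=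
  Real.sInf_nonneg fun _ hx => hx.1

section

variable {μ : Measure Torus} [IsProbabilityMeasure μ]

instance isProbabilityMeasure_map_torusAngle : IsProbabilityMeasure (μ.map torusAngle) :=
  Measure.isProbabilityMeasure_map measurable_torusAngle.aemeasurable

theorem distFun_eq_cdf (x : ℝ) : distFun μ x = ProbabilityTheory.cdf (μ.map torusAngle) x := by
  rw [distFun_eq, ProbabilityTheory.cdf_eq_real]

theorem distFun_two_pi : distFun μ (2 * Real.pi) = 1 := by
  have : torusAngle ⁻¹' Iic (2 * Real.pi) = univ :=
    eq_univ_of_forall fun θ => (torusAngle_lt θ).le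
  rw [distFun_eq, map_measureReal_apply measurable_torusAngle measurableSet_Iic, this]
  simp

/-- Right continuity of the distribution function makes the infimum attained. At $u=0$ the
equivalence fails for negative $x$. -/
theorem quantile_le_iff {u : ℝ} (hu : u ∈ Ioc (0 : ℝ) 1) (x : ℝ) :
    quantile μ u ≤ x ↔ u ≤ distFun μ x := by
  constructor
  · intro h
    have hright : Filter.Tendsto (distFun μ) (nhdsWithin x (Ioi x)) (nhds (distFun μ x)) := by
      have := ((ProbabilityTheory.cdf (μ.map torusAngle)).right_continuous x).mono_left
        (nhdsWithin_mono x Ioi_subset_Ici_self)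
      rwa [← show distFun μ = ProbabilityTheory.cdf (μ.map torusAngle) from
        funext distFun_eq_cdf] at this
    refine ge_of_tendsto hright ?_
    filter_upwards [self_mem_nhdsWithin] with y hy
    obtain ⟨z, hz, hzy⟩ := exists_lt_of_csInf_lt
      (⟨2 * Real.pi, by positivity, hu.2.trans distFun_two_pi.ge⟩ :
        {x : ℝ | 0 ≤ x ∧ u ≤ distFun μ x}.Nonempty) (h.trans_lt hy)
    refine hz.2.trans ?_
    rw [distFun_eq_cdf, distFun_eq_cdf]
    exact ProbabilityTheory.monotone_cdf _ hzy.le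
  · intro h
    have hx : 0 ≤ x := by
      by_contra hx
      rw [distFun_eq_zero (not_le.1 hx)] at h
      exact absurd hu.1 (not_lt.2 h)
    exact csInf_le ⟨0, fun y hy => hy.1⟩ ⟨hx, h⟩

theorem monotoneOn_quantile : MonotoneOn (quantile μ) (Icc 0 1) := by
  intro u hu v hv huv
  -- At $u=0$ the quantile is 0, because $0\le F_\mu(0)$.
  rcases hu.1.eq_or_lt with rfl | h
  · refine le_trans (csInf_le ⟨0, fun y hy => hy.1⟩ ⟨le_rfl, ?_⟩) (quantile_nonneg v)
    exact measureReal_nonneg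
  · rw [quantile_le_iff ⟨h, hu.2⟩]
    exact huv.trans ((quantile_le_iff ⟨h.trans_le huv, hv.2⟩ _).1 le_rfl)

theorem aemeasurable_quantile : AEMeasurable (quantile μ) (volume.restrict (Ioc (0 : ℝ) 1)) :=
  aemeasurable_restrict_of_monotoneOn measurableSet_Ioc
    (monotoneOn_quantile.mono Ioc_subset_Icc_self)

/-- The quantile function transports Lebesgue measure on `(0,1]` to `μ`. -/
theorem map_quantile :
    (volume.restrict (Ioc (0 : ℝ) 1)).map (quantile μ) = μ.map torusAngle := by
  have : IsProbabilityMeasure (volume.restrict (Ioc (0 : ℝ) 1)) := ⟨by simp⟩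
  have := Measure.isProbabilityMeasure_map (aemeasurable_quantile (μ := μ))
  refine Measure.ext_of_Iic _ _ fun x => ?_
  rw [Measure.map_apply_of_aemeasurable aemeasurable_quantile measurableSet_Iic,
    Measure.restrict_apply' measurableSet_Ioc]
  have hset : quantile μ ⁻¹' Iic x ∩ Ioc 0 1 = Ioc 0 (distFun μ x) := by
    ext u
    constructor
    · rintro ⟨h, hu⟩
      exact ⟨hu.1, (quantile_le_iff hu x).1 h⟩
    · rintro ⟨h0, h⟩
      have h1 : u ∈ Ioc (0 : ℝ) 1 := by
        refine ⟨h0, h.trans ?_⟩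
        rw [distFun_eq]
        exact measureReal_le_one
      exact ⟨(quantile_le_iff h1 x).2 h, h1⟩
  rw [hset, Real.volume_Ioc, sub_zero, distFun_eq, ofReal_measureReal]

theorem setIntegral_comp_quantile {E : Type*} [NormedAddCommGroup E] [NormedSpace ℝ E]
    {f : ℝ → E} (hf : StronglyMeasurable f) :
    ∫ u in Ioc (0 : ℝ) 1, f (quantile μ u) = ∫ θ, f (torusAngle θ) ∂μ := by
  rw [← integral_map aemeasurable_quantile hf.aestronglyMeasurable, map_quantile,
    integral_map measurable_torusAngle.aemeasurable hf.aestronglyMeasurable]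

/-- Otherwise monotonicity would carry all of $(u,1]$, of positive length, to $[2\pi,\infty)$, which
has no mass. -/
theorem quantile_lt_two_pi {u : ℝ} (hu : u ∈ Ico (0 : ℝ) 1) : quantile μ u < 2 * Real.pi := by
  by_contra h
  have h1 : (μ.map torusAngle) (Ici (2 * Real.pi)) = 0 := by
    rw [Measure.map_apply measurable_torusAngle measurableSet_Ici]
    convert measure_empty (μ := μ)
    exact eq_empty_of_forall_notMem fun θ hθ => absurd (torusAngle_lt θ) (not_lt.2 hθ)
  rw [← map_quantile, Measure.map_apply_of_aemeasurable aemeasurable_quantile measurableSet_Ici,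
    Measure.restrict_apply' measurableSet_Ioc] at h1
  have h2 : Ioc u 1 ⊆ quantile μ ⁻¹' Ici (2 * Real.pi) ∩ Ioc 0 1 := fun v hv =>
    ⟨(not_lt.1 h).trans (monotoneOn_quantile ⟨hu.1, hu.2.le⟩ ⟨hu.1.trans hv.1.le, hv.2⟩ hv.1.le),
      hu.1.trans_lt hv.1, hv.2⟩
  have h3 := measure_mono_null h2 h1
  rw [Real.volume_Ioc, ENNReal.ofReal_eq_zero] at h3
  linarith [hu.2]

end

/-! ### Assembling the proof: mixtures and Minkowski sums. -/

theorem isAngle_quantile {μ : Measure Torus} (hμ : μ ∈ centredMeasures) :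
    IsAngle (quantile μ) := by
  obtain ⟨hprob, hint⟩ := hμ
  refine ⟨monotoneOn_quantile, fun u _ => quantile_nonneg u, fun u hu => quantile_lt_two_pi hu, ?_⟩
  rw [intervalIntegral.integral_of_le zero_le_one, setIntegral_comp_quantile
    (f := fun x : ℝ => Complex.exp (Complex.I * (x : ℂ)))
    (Continuous.stronglyMeasurable (by fun_prop)), ← hint]
  exact integral_congr_ae (Filter.Eventually.of_forall fun θ =>
    (toCircle_eq_exp_torusAngle θ).symm)

theorem integral_mixture {E : Type*} [NormedAddCommGroup E] [NormedSpace ℝ E] {lam : ℝ}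
    (hlam : lam ∈ Icc (0 : ℝ) 1) {μ ν : Measure Torus} {f : Torus → E} (hμ : Integrable f μ)
    (hν : Integrable f ν) :
    ∫ θ, f θ ∂(mixture lam μ ν) = lam • ∫ θ, f θ ∂μ + (1 - lam) • ∫ θ, f θ ∂ν := by
  rw [mixture, integral_add_measure (hμ.smul_measure ENNReal.ofReal_ne_top)
    (hν.smul_measure ENNReal.ofReal_ne_top), integral_smul_measure, integral_smul_measure,
    ENNReal.toReal_ofReal hlam.1, ENNReal.toReal_ofReal (sub_nonneg.2 hlam.2)]

theorem mixture_mem_centredMeasures {lam : ℝ} (hlam : lam ∈ Icc (0 : ℝ) 1) {μ ν : Measure Torus}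
    (hμ : μ ∈ centredMeasures) (hν : ν ∈ centredMeasures) :
    mixture lam μ ν ∈ centredMeasures := by
  obtain ⟨hμp, hμ⟩ := hμ
  obtain ⟨hνp, hν⟩ := hν
  have hcont : Continuous fun θ : Torus => ((AddCircle.toCircle θ : Circle) : ℂ) :=
    continuous_subtype_val.comp AddCircle.continuous_toCircle
  have hi : ∀ (ρ : Measure Torus) [IsProbabilityMeasure ρ],
      Integrable (fun θ : Torus => ((AddCircle.toCircle θ : Circle) : ℂ)) ρ := fun ρ _ =>
    Integrable.of_bound hcont.measurable.aestronglyMeasurable 1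
      (Filter.Eventually.of_forall fun θ => (Circle.norm_coe _).le)
  refine ⟨⟨?_⟩, ?_⟩
  · simp only [mixture, Measure.add_apply, Measure.smul_apply, measure_univ, smul_eq_mul, mul_one]
    rw [← ENNReal.ofReal_add hlam.1 (sub_nonneg.2 hlam.2)]
    simp
  · rw [integral_mixture hlam (hi μ) (hi ν), hμ, hν]
    simp

theorem convexHull_curve_mem_convOne {μ : Measure Torus} (hμ : μ ∈ centredMeasures) :
    convexHull ℝ (curve μ) ∈ convOne :=
  (isAngle_quantile hμ).convexHull_mem_convOne

theorem ccsBoundary_convexHull_curve {μ : Measure Torus} (hμ : μ ∈ centredMeasures) :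
    ccsBoundary (convexHull ℝ (curve μ)) = curve μ :=
  (isAngle_quantile hμ).ccsBoundary_convexHull

theorem eq_convexHull_curve {μ : Measure Torus} {S : Set ℂ} (hS : S ∈ convOne)
    (h : ccsBoundary S = curve μ) : S = convexHull ℝ (curve μ) := by
  rw [← h, convexHull_ccsBoundary hS.1.2.1 hS.1.2.2]

theorem ccs_eq_convexHull_curve {μ : Measure Torus} (hμ : μ ∈ centredMeasures) :
    ccs μ = convexHull ℝ (curve μ) :=
  have h : ∃ S ∈ convOne, ccsBoundary S = curve μ :=
    ⟨_, convexHull_curve_mem_convOne hμ, ccsBoundary_convexHull_curve hμ⟩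
  eq_convexHull_curve (Function.invFunOn_mem h) (Function.invFunOn_eq h)

/-- The integrand depends on $c$ alone, so the support function is affine under mixtures. -/
theorem isLeast_height_convexHull_curve {μ : Measure Torus} (hμ : μ ∈ centredMeasures) {c : ℝ}
    (hc : c ∈ Ico 0 (2 * Real.pi)) :
    IsLeast (height c '' convexHull ℝ (curve μ))
      (∫ θ, (Iic c).indicator (fun x => Real.sin (x - c)) (torusAngle θ) ∂μ) := by
  have := hμ.1
  rw [← setIntegral_comp_quantile]
  · exact (isAngle_quantile hμ).isLeast_height_convexHull hc
  · exact (Continuous.stronglyMeasurable (by fun_prop)).indicator measurableSet_Iic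

theorem convexHull_curve_mixture {lam : ℝ} (hlam : lam ∈ Icc (0 : ℝ) 1) {μ ν : Measure Torus}
    (hμ : μ ∈ centredMeasures) (hν : ν ∈ centredMeasures) :
    convexHull ℝ (curve (mixture lam μ ν)) =
      lam • convexHull ℝ (curve μ) + (1 - lam) • convexHull ℝ (curve ν) := by
  have hmix := mixture_mem_centredMeasures hlam hμ hν
  have hcomp : ∀ {ρ : Measure Torus}, ρ ∈ centredMeasures → IsCompact (convexHull ℝ (curve ρ)) :=
    fun hρ => (isAngle_quantile hρ).isCompact_convexHull
  refine eq_of_isLeast_height (hcomp hmix).isClosed (convex_convexHull ℝ _)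
    (((hcomp hμ).smul lam).add ((hcomp hν).smul (1 - lam))).isClosed
    (((convex_convexHull ℝ _).smul lam).add ((convex_convexHull ℝ _).smul (1 - lam)))
    fun c hc => ⟨_, isLeast_height_convexHull_curve hmix hc, ?_⟩
  have hi : ∀ {ρ : Measure Torus}, ρ ∈ centredMeasures →
      Integrable (fun θ => (Iic c).indicator (fun x => Real.sin (x - c)) (torusAngle θ)) ρ := by
    intro ρ hρ
    have := hρ.1
    refine Integrable.of_bound (C := 1) ?_ (Filter.Eventually.of_forall fun θ => ?_)
    · exact (((by fun_prop : Measurable fun x : ℝ => Real.sin (x - c)).indicator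
        measurableSet_Iic).comp measurable_torusAngle).aestronglyMeasurable
    · exact (norm_indicator_le_norm_self _ _).trans (Real.abs_sin_le_one _)
  rw [integral_mixture hlam (hi hμ) (hi hν)]
  exact isLeast_image_smul_add_smul hlam.1 (sub_nonneg.2 hlam.2)
    (isLeast_height_convexHull_curve hμ hc) (isLeast_height_convexHull_curve hν hc)

end MixtureMinkowski

theorem mainTheorem4
    (μ ν : MeasureTheory.Measure MixtureMinkowski.Torus)
    (hμ : μ ∈ MixtureMinkowski.centredMeasures)
    (hν : ν ∈ MixtureMinkowski.centredMeasures)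
    (lam : ℝ) (hlam : lam ∈ Set.Icc (0 : ℝ) 1) :
    MixtureMinkowski.mixture lam μ ν ∈ MixtureMinkowski.centredMeasures ∧
    (∀ ρ ∈ ({μ, ν, MixtureMinkowski.mixture lam μ ν} :
        Set (MeasureTheory.Measure MixtureMinkowski.Torus)),
      MixtureMinkowski.ccs ρ ∈ MixtureMinkowski.convOne ∧
      MixtureMinkowski.ccsBoundary (MixtureMinkowski.ccs ρ) = MixtureMinkowski.curve ρ ∧
      ∀ S ∈ MixtureMinkowski.convOne,
        MixtureMinkowski.ccsBoundary S = MixtureMinkowski.curve ρ →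
          S = MixtureMinkowski.ccs ρ) ∧
    MixtureMinkowski.ccs (MixtureMinkowski.mixture lam μ ν) =
      lam • MixtureMinkowski.ccs μ + (1 - lam) • MixtureMinkowski.ccs ν := by
  have hmix := MixtureMinkowski.mixture_mem_centredMeasures hlam hμ hν
  refine ⟨hmix, fun ρ hρ => ?_, ?_⟩
  · have hρ' : ρ ∈ MixtureMinkowski.centredMeasures := by
      rcases hρ with rfl | rfl | rfl
      exacts [hμ, hν, hmix]
    rw [MixtureMinkowski.ccs_eq_convexHull_curve hρ']
    exact ⟨MixtureMinkowski.convexHull_curve_mem_convOne hρ',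
      MixtureMinkowski.ccsBoundary_convexHull_curve hρ',
      fun S hS h => MixtureMinkowski.eq_convexHull_curve hS h⟩
  · rw [MixtureMinkowski.ccs_eq_convexHull_curve hmix, MixtureMinkowski.ccs_eq_convexHull_curve hμ,
      MixtureMinkowski.ccs_eq_convexHull_curve hν]
    exact MixtureMinkowski.convexHull_curve_mixture hlam hμ hν
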